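/- **Theorem ($\gamma$-batch-order-fairness of Herring).** Let $\tfrac12<\gamma\le 1$ and $n>\frac{4f}{2\gamma-1}$. Consider any run, over an asynchronous network, of the protocol below with $n$ replicas, of which at most $f$ are Byzantine. Let $tx,tx'$ be transactions received by all replicas such that at least $\gamma n$ replicas receive $tx$ before $tx'$. Then every correct replica outputs $tx$ no later than $tx'$: whenever $tx'$ is in its output, $tx$ has been output before $tx'$, or $tx$ and $tx'$ belong to the same batch. *Batches.* Write $a\to b$ if more than $n(1-\gamma)$ correct replicas receive $a$ before $b$ (a replica that receives $a$ and never receives $b$ receives $a$ before $b$). Two transactions lie on the same Condorcet cycle if each can be reached from the other along $\to$. A transaction $tx$ that follows $tx'$ in the output, or is not yet output, is in the batch of $tx'$ if $tx$ and all transactions output from $tx'$ on up to $tx$ (or, if $tx$ is not yet output, all those output so far from $tx'$ on) lie on the same Condorcet cycle as $tx'$. *Consensus layer (Narwhal & Tusk).* A DAG vertex has an author, a round, references and a payload. It is certified when $n-f$ replicas have signed it. A correct replica signs at most one vertex per author and round, signs a vertex in the name of a correct replica only if that replica proposed it, and signs a vertex of a round after the first only if its references are to certified vertices of the preceding round by at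 least $n-f$ authors. Each vertex proposed by a correct replica in a later round references that replica's own vertex of the preceding round. Each correct replica has a growing, causally closed local DAG of certified vertices. A shared coin assigns a leader to each wave of at least two rounds. A correct replica may directly commit the wave leader's vertex of the first round of a wave when at least $f+1$ vertices of the next round in its local DAG reference it. Before that vertex it commits, going back through the waves since its last direct commit, each leader vertex that is in the causal history of the leader vertex found last. The subdag $A_r$ of the $r$-th committed leader is its causal history without the histories of the earlier committed leaders. *Reports.* A correct replica gives each transaction, on first observation, a local ordering indicator (LOI) from an increasing counter, and reports transactions in its vertices in LOI order and without gaps. The cumulative ordering of replica $j$ at $A_r$ lists the transactions reported in $j$'s vertices in the subdags up to $A_r$; those of each subdag are appended in LOI order, without repetition. Byzantine replicas may report anything. *Graph construction.* Put $\tau=\lfloor n(1-\gamma)\rfloor+f+1$ and $\tau_s=n-2f$. When a correct replica commits $A_r$, it extracts the snapshot $L_1,\dots,L_n$ of the cumulative orderings, from which it omits the sets $K_q$ of the tasks $q<r$ that have returned and the solid transactions of the snapshots of the other tasks $q<r$. Tasks run in parallel and return at arbitrary times. A list places $u$ before $v$ if it contains $u$ and either contains $v$ at a later position or does not contain $v$.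 Let $w_{uv}$ be the number of lists of the snapshot that place $u$ before $v$. Transactions contained in at least $\tau$ lists are non-blank, those in at least $\tau_s$ lists solid. The graph has as vertices the non-blank transactions outside $\bigcup_{q<r}K_q$. A pair $\{u,v\}$ gets an edge in the direction of the larger weight if that weight is at least $\tau$, and is missing otherwise. The strongly connected components are sorted topologically, the components after the last one that contains a solid transaction are cut off, and $K_r$ is the set of remaining vertices. *Finalization and output.* If pairs of $A_r$ are missing, then the correct replicas that have committed $A_r$ may send, in their vertices, votes that direct all of these pairs by LOI. A replica that has found votes for $A_r$ by at least $n-f$ replicas in committed subdags adds, for every missing pair, the edge in the direction with more votes if it has at least $\tau$ votes. The order of $A_r$ lists the strongly connected components of the resulting graph in topological order, and the transactions of each component in any order. A correct replica outputs the orders of $A_0,A_1,\dots$ one after the other, each only after it is finalized. The routines for topological sorting, for ordering a component and for breaking ties are deterministic, the same for all correct replicas, and otherwise arbitrary. -/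

import Mathlib

open scoped Classical

noncomputable section

namespace Herring

/-! ### Dependency graphs, strongly connected components, topological sorting -/

/-- A finite directed graph on transactions. -/
@[ext]
structure DepGraph (Tx : Type*) where
  verts : Finset Tx
  edges : Finset (Tx × Tx)

namespace DepGraph

variable {Tx : Type*}

/-- All edges join vertices of the graph. -/
def WellFormed (G : DepGraph Tx) : Prop := G.edges ⊆ G.verts ×ˢ G.verts

/-- There is a directed path (possibly of length `0`) from `u` to `v`. -/
def Reaches (G : DepGraph Tx) : Tx → Tx → Prop :=
  Relation.ReflTransGen (fun a b => (a, b) ∈ G.edges)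

/-- The strongly connected component of `u`. -/
def scc (G : DepGraph Tx) (u : Tx) : Finset Tx :=
  G.verts.filter (fun v => G.Reaches u v ∧ G.Reaches v u)

/-- `l` lists every strongly connected component of `G` exactly once, and no edge leads from a
component to an earlier one. -/
def IsTopoSort (G : DepGraph Tx) (l : List (Finset Tx)) : Prop :=
  l.Nodup ∧ (∀ C, C ∈ l ↔ ∃ u ∈ G.verts, C = G.scc u) ∧
    l.Pairwise (fun C D => ∀ u ∈ C, ∀ v ∈ D, (v, u) ∉ G.edges)

/-- The subgraph induced on `K`. -/
def restrict (G : DepGraph Tx) (K : Finset Tx) : DepGraph Tx where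
  verts := G.verts ∩ K
  edges := G.edges.filter (fun p => p.1 ∈ K ∧ p.2 ∈ K)

end DepGraph

/-! ### Parameters of the protocol -/

/-- The public parameters: number `n` of replicas, number `f` of tolerated Byzantine replicas,
fairness parameter `γ`, wave length of the consensus layer, and the deterministic routines that all
correct replicas use for sorting the strongly connected components of a graph topologically and
for listing the transactions of one component. Any such routines are allowed. -/
structure Params (Tx : Type*) where
  n : ℕ
  f : ℕ
  γ : ℝ
  waveLength : ℕ
  two_le_waveLength : 2 ≤ waveLength
  topoSort : DepGraph Tx → List (Finset Tx)
  topoSort_spec : ∀ G : DepGraph Tx, G.WellFormed → G.IsTopoSort (topoSort G)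
  linearize : DepGraph Tx → Finset Tx → List Tx
  linearize_spec : ∀ G C, (linearize G C).Nodup ∧ (linearize G C).toFinset = C

namespace Params

variable {Tx : Type*} (P : Params Tx)

/-- The non-blank (and edge) threshold `n(1-γ) + f + 1`, with `n(1-γ)` rounded down. -/
def tau : ℕ := ⌊(P.n : ℝ) * (1 - P.γ)⌋₊ + P.f + 1

/-- The solid threshold `n - 2f`. -/
def tauSolid : ℕ := P.n - 2 * P.f

end Params

/-! ### Graph construction for one subdag, edge resolution, finalization -/

section Task

variable {Tx : Type*} [LinearOrder Tx] (P : Params Tx)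

/-- `u` is placed before `v` by the ordering `L`: a transaction that `L` contains comes before all
transactions that `L` does not contain. -/
def PlacesBefore (L : List Tx) (u v : Tx) : Prop :=
  u ∈ L ∧ (v ∈ L → L.idxOf u < L.idxOf v)

/-- Number of orderings that contain `tx`. -/
def support (L : Fin P.n → List Tx) (tx : Tx) : ℕ :=
  (Finset.univ.filter (fun i => tx ∈ L i)).card

/-- Number of orderings that place `u` before `v`. -/
def weight (L : Fin P.n → List Tx) (u v : Tx) : ℕ :=
  (Finset.univ.filter (fun i => PlacesBefore (L i) u v)).card

/-- The transactions that occur in some ordering. -/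
def appearing (L : Fin P.n → List Tx) : Finset Tx :=
  Finset.univ.biUnion (fun i => (L i).toFinset)

/-- The solid transactions of a snapshot. -/
def solids (L : Fin P.n → List Tx) : Finset Tx :=
  (appearing P L).filter (fun tx => P.tauSolid ≤ support P L tx)

/-- The unordered pairs of distinct elements of `W`, each represented by its increasing
enumeration. -/
def pairs (W : Finset Tx) : Finset (Tx × Tx) :=
  (W ×ˢ W).filter (fun p => p.1 < p.2)

/-- The edges obtained from the tally `w` on the pairs in `S`: a pair gets an edge if the larger
tally reaches the threshold, `(u, v)` if `w u v ≥ w v u` and `(v, u)` otherwise. -/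
def tallyEdges (w : Tx → Tx → ℕ) (S : Finset (Tx × Tx)) : Finset (Tx × Tx) :=
  (S.filter (fun p => P.tau ≤ max (w p.1 p.2) (w p.2 p.1))).image
    (fun p => if w p.2 p.1 ≤ w p.1 p.2 then (p.1, p.2) else (p.2, p.1))

/-- The outcome of the graph construction task of a subdag: the solid transactions of its snapshot,
the truncated graph, its missing pairs, and the number of components up to the anchor. -/
structure TaskResult (Tx : Type*) where
  solid : Finset Tx
  graph : DepGraph Tx
  missing : Finset (Tx × Tx)
  anchor : ℕ

/-- The graph construction task, from the snapshot `L` and the set `prior` of all transactions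
that were retained in graphs of earlier subdags. Support and weights are computed from the
snapshot; then the transactions in `prior` are dropped. The components behind the last one that
contains a solid transaction are cut off; everything is cut off if there is no such component. -/
def buildTask (L : Fin P.n → List Tx) (prior : Finset Tx) : TaskResult Tx :=
  let S := solids P L
  let V₀ := (appearing P L).filter (fun tx => P.tau ≤ support P L tx)
  let w := weight P L
  let W := V₀ \ prior
  let G : DepGraph Tx := ⟨W, tallyEdges P w (pairs W)⟩
  let M := (pairs W).filter (fun p => max (w p.1 p.2) (w p.2 p.1) < P.tau)
  let kept := (P.topoSort G).rdropWhile (fun C => decide (Disjoint C S))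
  let K := W.filter (fun tx => ∃ C ∈ kept, tx ∈ C)
  { solid := S
    graph := G.restrict K
    missing := M.filter (fun p => p.1 ∈ K ∧ p.2 ∈ K)
    anchor := kept.length }

/-- The order in which the transactions of a completed graph are output. -/
def finalize (G : DepGraph Tx) (a : ℕ) : List Tx :=
  ((P.topoSort G).take a).flatMap (P.linearize G)

/-- Adding the edges decided by the votes, `vts a` being the set of directed edges for which
replica `a` voted. -/
def applyFairUpdate (T : TaskResult Tx) (vts : Fin P.n → Finset (Tx × Tx)) : DepGraph Tx where
  verts := T.graph.verts
  edges := T.graph.edges ∪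
    tallyEdges P (fun u v => (Finset.univ.filter (fun a => (u, v) ∈ vts a)).card) T.missing

/-- Appending new transactions to an ordering; one that is already present is not repeated. -/
def ingest (old new : List Tx) : List Tx :=
  new.foldl (fun l tx => if tx ∈ l then l else l ++ [tx]) old

end Task

/-! ### Runs of the system -/

/-- The data of a run. `V` is the type of DAG vertices, which are identified with their digests.
Times are local to each replica, subdags are numbered `0, 1, 2, …` in commit order. What the fields
say about Byzantine replicas is irrelevant, except for `recv` and `signed` and for the contents of
their vertices, which are arbitrary. -/
structure Trace {Tx : Type*} (P : Params Tx) (V : Type*) where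
  /-- the replica that a vertex names as its creator -/
  author : V → Fin P.n
  /-- the DAG round of a vertex -/
  round : V → ℕ
  /-- the vertices that a vertex references -/
  parents : V → Finset V
  /-- the (direct and indirect) entries of the batches in a vertex: transactions with local
  ordering indicators (LOIs) -/
  entries : V → List (Tx × ℕ)
  /-- the FairUpdate votes in a vertex: number of the target subdag, set of directed edges -/
  votes : V → List (ℕ × Finset (Tx × Tx))
  /-- the correct replicas -/
  correct : Finset (Fin P.n)
  /-- the position of the first observation of a transaction in the receive order of a replica,
  `⊤` if the replica never receives it; for a correct replica this is the LOI it assigns -/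
  recv : Fin P.n → Tx → ℕ∞
  /-- the vertex that a correct replica proposes in a round, if any -/
  proposal : Fin P.n → ℕ → Option V
  /-- the replica has signed the vertex -/
  signed : Fin P.n → V → Prop
  /-- the leader of each wave, given by the shared coin -/
  coin : ℕ → Fin P.n
  /-- the local DAG of a replica at a time -/
  view : Fin P.n → ℕ → Finset V
  /-- the wave, if any, whose leader the replica commits directly at a time -/
  commitWave : Fin P.n → ℕ → Option ℕ
  /-- `returned i r`: the subdags whose tasks have returned to the main thread of replica `i` when
  it extracts the snapshot of subdag `r` -/
  returned : Fin P.n → ℕ → Finset ℕ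
  /-- `resolvedAt i r`: the number of committed subdags whose votes replica `i` has collected when
  it runs ApplyFairUpdate on subdag `r` (if it does) -/
  resolvedAt : Fin P.n → ℕ → ℕ
  /-- the number of subdags whose order the replica has emitted at a time -/
  emitted : Fin P.n → ℕ → ℕ

namespace Trace

section Consensus

variable {Tx : Type*} {P : Params Tx} {V : Type*} (E : Trace P V)

/-- The vertex carries signatures of `n - f` replicas. -/
def Certified (v : V) : Prop :=
  ∃ Q : Finset (Fin P.n), P.n - P.f ≤ Q.card ∧ ∀ j ∈ Q, E.signed j v

/-- The vertices reached from `v` by following at most `k` references. -/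
def historyUpTo : ℕ → V → Finset V
  | 0, v => {v}
  | k + 1, v => insert v ((E.parents v).biUnion (historyUpTo k))

/-- The causal history of `v`, including `v`; references lower the round by one. -/
def history (v : V) : Finset V := E.historyUpTo (E.round v) v

/-- `v` is a vertex of the leader of wave `w` in the first round of the wave. -/
def IsLeader (w : ℕ) (v : V) : Prop :=
  E.round v = P.waveLength * w ∧ E.author v = E.coin w

/-- The leader vertex of wave `w` in the set `S`, if any. -/
def leaderIn (S : Finset V) (w : ℕ) : Option V :=
  if h : ∃ v, v ∈ S ∧ E.IsLeader w v then some h.choose else none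

/-- The leaders committed together with `cur`, in increasing order of waves and with `cur` last: run
through the waves `lo + m - 1, …, lo + 1, lo`; whenever the history of the current leader contains
the leader of the wave, commit that leader and make it the current one. -/
def leaderChain (lo : ℕ) : ℕ → V → List V
  | 0, cur => [cur]
  | m + 1, cur =>
    match E.leaderIn (E.history cur) (lo + m) with
    | none => leaderChain lo m cur
    | some u => leaderChain lo m u ++ [cur]

/-- The leaders committed by replica `i` before time `t`, in commit order, and the first wave behind
the last directly committed one. -/
def commitState (i : Fin P.n) : ℕ → List V × ℕ
  | 0 => ([], 0)
  | t + 1 =>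
    match E.commitWave i t with
    | none => commitState i t
    | some w =>
      match E.leaderIn (E.view i t) w with
      | none => commitState i t
      | some v =>
        ((commitState i t).1 ++ E.leaderChain (commitState i t).2 (w - (commitState i t).2) v,
          w + 1)

/-- The leaders committed by replica `i` before time `t`, in commit order. -/
def leaders (i : Fin P.n) (t : ℕ) : List V := (E.commitState i t).1

/-- The `r`-th subdag for the sequence `ls` of committed leaders: the history of the `r`-th leader
without the histories of the earlier ones. -/
def subdag (ls : List V) (r : ℕ) : Finset V :=
  match ls[r]? with
  | none => ∅
  | some v => E.history v \ (ls.take r).toFinset.biUnion E.history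

end Consensus

section Fairness

variable {Tx : Type*} [LinearOrder Tx] {P : Params Tx} {V : Type*} (E : Trace P V)

/-- The transactions that replica `j` reports in the set `A` of vertices, in LOI order. -/
def contribution (A : Finset V) (j : Fin P.n) : List Tx :=
  (((A.filter (fun v => E.author v = j)).toList.flatMap E.entries).mergeSort
    (fun a b => decide (a.2 ≤ b.2))).map Prod.fst

/-- The cumulative ordering of replica `j` from the first `r` subdags. -/
def ordering (ls : List V) (j : Fin P.n) : ℕ → List Tx
  | 0 => []
  | r + 1 => ingest (ordering ls j r) (E.contribution (E.subdag ls r) j)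

/-- The transactions excluded from the next snapshot, given the results of all earlier tasks and the
set `ret` of those that have returned to the main thread: the retained transactions of the
returned tasks and the solid claims of the tasks in flight. -/
def excluded (prev : List (TaskResult Tx)) (ret : Finset ℕ) : Finset Tx :=
  (Finset.range prev.length).biUnion (fun q =>
    match prev[q]? with
    | none => ∅
    | some T => if q ∈ ret then T.graph.verts else T.solid)

/-- The transactions retained in the graphs of earlier subdags (the cumulative chain). -/
def priorCumulative (prev : List (TaskResult Tx)) : Finset Tx :=
  prev.toFinset.biUnion (fun T => T.graph.verts)

/-- The snapshot of subdag `r`: for every replica its cumulative ordering without the excluded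
transactions. -/
def snapshot (ls : List V) (ret : Finset ℕ) (prev : List (TaskResult Tx)) (r : ℕ)
    (j : Fin P.n) : List Tx :=
  (E.ordering ls j (r + 1)).filter (fun tx => decide (tx ∉ excluded prev ret))

/-- The results of the tasks of the first `r` subdags; `ret q` is the set of tasks that have returned
when the snapshot of subdag `q` is extracted. -/
def taskResults (ls : List V) (ret : ℕ → Finset ℕ) : ℕ → List (TaskResult Tx)
  | 0 => []
  | r + 1 => taskResults ls ret r ++
      [buildTask P (E.snapshot ls (ret r) (taskResults ls ret r) r)
        (priorCumulative (taskResults ls ret r))]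

/-- The result of the task of subdag `r`. -/
def task (ls : List V) (ret : ℕ → Finset ℕ) (r : ℕ) : TaskResult Tx :=
  buildTask P (E.snapshot ls (ret r) (E.taskResults ls ret r) r)
    (priorCumulative (E.taskResults ls ret r))

/-- The vertices of replica `a` in the first `q` subdags. -/
def committedBy (ls : List V) (q : ℕ) (a : Fin P.n) : Finset V :=
  ((Finset.range q).biUnion (E.subdag ls)).filter (fun v => E.author v = a)

/-- The directed edges for which replica `a` has voted, for target subdag `r`, in the first `q`
subdags. -/
def votesOf (ls : List V) (q r : ℕ) (a : Fin P.n) : Finset (Tx × Tx) :=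
  (E.committedBy ls q a).biUnion (fun v =>
    ((E.votes v).filter (fun b => decide (b.1 = r))).toFinset.biUnion Prod.snd)

/-- The replicas that have sent a vote for target subdag `r` in the first `q` subdags. -/
def voters (ls : List V) (q r : ℕ) : Finset (Fin P.n) :=
  Finset.univ.filter (fun a => ∃ v ∈ E.committedBy ls q a, ∃ b ∈ E.votes v, b.1 = r)

/-- The task result of replica `i` for subdag `r`, from the leaders committed before time `t`. -/
def taskAt (i : Fin P.n) (t r : ℕ) : TaskResult Tx :=
  E.task (E.leaders i t) (E.returned i) r

/-- The finalized order of replica `i` for subdag `r`: at once if no pair is missing, and from the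
votes collected otherwise. -/
def order (i : Fin P.n) (t r : ℕ) : List Tx :=
  if (E.taskAt i t r).missing = ∅ then
    finalize P (E.taskAt i t r).graph (E.taskAt i t r).anchor
  else
    finalize P
      (applyFairUpdate P (E.taskAt i t r) (E.votesOf (E.leaders i t) (E.resolvedAt i r) r))
      (E.taskAt i t r).anchor

/-- The transactions output by replica `i` before time `t`, in output order. -/
def log (i : Fin P.n) (t : ℕ) : List Tx :=
  (List.range (E.emitted i t)).flatMap (E.order i t)

/-- The vote of replica `i` on the missing pairs `M`: each pair is directed by LOI. -/
def directedVote (i : Fin P.n) (M : Finset (Tx × Tx)) : Finset (Tx × Tx) :=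
  M.image (fun p => if E.recv i p.1 < E.recv i p.2 then (p.1, p.2) else (p.2, p.1))

/-- The run obeys the rules: at most `f` replicas are Byzantine, and the others follow the
protocol. -/
structure IsExecution : Prop where
  /-- at most `f` replicas are corrupted -/
  byzantine : (Finset.univ \ E.correct).card ≤ P.f
  /-- LOIs are assigned by a strictly increasing counter, once per transaction -/
  recv_injective : ∀ i ∈ E.correct, ∀ tx tx', E.recv i tx = E.recv i tx' → E.recv i tx ≠ ⊤ →
    tx = tx'
  /-- a correct replica names itself and the round in its proposals -/
  proposal_header : ∀ i ∈ E.correct, ∀ ρ v, E.proposal i ρ = some v →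
    E.author v = i ∧ E.round v = ρ
  /-- self-referencing rule -/
  self_reference : ∀ i ∈ E.correct, ∀ ρ v, E.proposal i (ρ + 1) = some v →
    ∃ u, E.proposal i ρ = some u ∧ u ∈ E.parents v
  /-- a correct replica reports transactions with the LOIs that it has assigned -/
  entries_loi : ∀ i ∈ E.correct, ∀ ρ v, E.proposal i ρ = some v →
    ∀ e ∈ E.entries v, E.recv i e.1 = (e.2 : ℕ∞)
  /-- a correct replica seals transactions in LOI order: when it reports one, then it reports those
  with a smaller LOI in the same vertex unless it has done so before -/
  entries_sealed : ∀ i ∈ E.correct, ∀ ρ v, E.proposal i ρ = some v →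
    ∀ e ∈ E.entries v, ∀ tx, E.recv i tx < E.recv i e.1 →
      ∃ ρ' ≤ ρ, ∃ v', E.proposal i ρ' = some v' ∧ ∃ e' ∈ E.entries v', e'.1 = tx
  /-- a correct replica votes only on subdags that it has committed and parked; it votes when it
  knows both LOIs for every missing pair, and directs all missing pairs by LOI -/
  votes_honest : ∀ i ∈ E.correct, ∀ ρ v, E.proposal i ρ = some v → ∀ b ∈ E.votes v,
    ∃ t, b.1 < (E.leaders i t).length ∧ (E.taskAt i t b.1).missing ≠ ∅ ∧
      (∀ p ∈ (E.taskAt i t b.1).missing, E.recv i p.1 ≠ ⊤ ∧ E.recv i p.2 ≠ ⊤) ∧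
      b.2 = E.directedVote i (E.taskAt i t b.1).missing
  /-- vertices of correct replicas cannot be forged: a correct replica signs a vertex in the name of
  a correct replica only if the latter has proposed it -/
  signed_authentic : ∀ j ∈ E.correct, ∀ v, E.signed j v → E.author v ∈ E.correct →
    E.proposal (E.author v) (E.round v) = some v
  /-- a correct replica signs at most one vertex for each author and round -/
  signed_unique : ∀ j ∈ E.correct, ∀ v v', E.signed j v → E.signed j v' →
    E.author v = E.author v' → E.round v = E.round v' → v = v'
  /-- a correct replica signs no vertex of the first round that has references -/
  signed_first : ∀ j ∈ E.correct, ∀ v, E.signed j v → E.round v = 0 → E.parents v = ∅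
  /-- a correct replica signs a later vertex only if all its references are to certified vertices of
  the preceding round, by at least `n - f` authors -/
  signed_valid : ∀ j ∈ E.correct, ∀ v, E.signed j v → E.round v ≠ 0 →
    (∀ u ∈ E.parents v, E.round u + 1 = E.round v ∧ E.Certified u) ∧
      P.n - P.f ≤ ((E.parents v).image E.author).card
  /-- local DAGs hold certified vertices only -/
  view_certified : ∀ i ∈ E.correct, ∀ t, ∀ v ∈ E.view i t, E.Certified v
  /-- local DAGs are causally complete -/
  view_closed : ∀ i ∈ E.correct, ∀ t, ∀ v ∈ E.view i t, E.parents v ⊆ E.view i t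
  /-- local DAGs only grow -/
  view_mono : ∀ i ∈ E.correct, Monotone (E.view i)
  /-- a leader is committed directly only for a wave behind the last one, and only if it is in the
  local DAG and is referenced there by at least `f + 1` vertices of the next round -/
  commit_rule : ∀ i ∈ E.correct, ∀ t w, E.commitWave i t = some w →
    (E.commitState i t).2 ≤ w ∧ ∃ v, E.leaderIn (E.view i t) w = some v ∧
      P.f + 1 ≤ ((E.view i t).filter
        (fun u => E.round u = E.round v + 1 ∧ v ∈ E.parents u)).card
  /-- only tasks of earlier subdags can have returned -/
  returned_lt : ∀ i ∈ E.correct, ∀ r, ∀ q ∈ E.returned i r, q < r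
  /-- a task that has returned stays so -/
  returned_mono : ∀ i ∈ E.correct, Monotone (E.returned i)
  /-- what has been emitted stays so -/
  emitted_mono : ∀ i ∈ E.correct, Monotone (E.emitted i)
  /-- only committed subdags are emitted, in commit order, and only when they are finalized: if a pair
  is missing, then votes from `n - f` replicas must have been collected from committed subdags -/
  emit_rule : ∀ i ∈ E.correct, ∀ t, E.emitted i t ≤ (E.leaders i t).length ∧
    ∀ r < E.emitted i t, (E.taskAt i t r).missing ≠ ∅ →
      E.resolvedAt i r ≤ (E.leaders i t).length ∧
        P.n - P.f ≤ (E.voters (E.leaders i t) (E.resolvedAt i r) r).card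

/-! ### Batches and fairness -/

/-- More than `n(1-γ)` correct replicas receive `a` before `b`. -/
def CondorcetEdge (a b : Tx) : Prop :=
  (P.n : ℝ) * (1 - P.γ) <
    ((E.correct.filter (fun i => E.recv i a < E.recv i b)).card : ℝ)

/-- `a` and `b` lie on a common Condorcet cycle (or coincide). -/
def SameCycle (a b : Tx) : Prop :=
  Relation.ReflTransGen E.CondorcetEdge a b ∧ Relation.ReflTransGen E.CondorcetEdge b a

/-- `tx` is output before `tx'` in `l`. -/
def OutputBefore (l : List Tx) (tx tx' : Tx) : Prop :=
  tx ∈ l ∧ tx' ∈ l ∧ l.idxOf tx < l.idxOf tx'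

/-- `tx` belongs to the batch of the output transaction `tx'`: they lie on a common Condorcet cycle
with each other and with everything that is output from `tx'` on until `tx` (everything output from
`tx'` on so far, if `tx` has not been output yet). -/
def JoinsBatch (l : List Tx) (tx' tx : Tx) : Prop :=
  E.SameCycle tx' tx ∧
    ∀ z ∈ l, l.idxOf tx' ≤ l.idxOf z → (tx ∈ l → l.idxOf z ≤ l.idxOf tx) → E.SameCycle tx' z

/-- In the output `l`, `tx` comes no later than `tx'`: once `tx'` is output, `tx` has been output
before or belongs to the same batch. -/
def OutputNoLater (l : List Tx) (tx tx' : Tx) : Prop :=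
  tx' ∈ l → OutputBefore l tx tx' ∨ E.JoinsBatch l tx' tx

end Fairness

end Trace

end Herring

end

/-! The core is `log_spec`: along Condorcet edges, every output transaction reaches all that are
output after it and all that are not yet output. Since `γ n - f > n (1 - γ)`, the pair `tx → tx'` is
itself a Condorcet edge. If `tx` is not output before `tx'`, then `tx'` reaches every `z` output
from `tx'` on up to `tx`, every such `z` reaches `tx`, and the edge `tx → tx'` closes a cycle
through all of them.

An edge backed by `τ` lists or votes is backed by more than `n (1 - γ)` correct replicas, so it is a
Condorcet edge (`condorcetEdge_of_card`) as soon as lists and votes of correct replicas reflect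
receive orders (`recv_lt_of_placesBefore`, `votesOf_correct`). The bound on `n` gives `2 τ + 2 f ≤ n
+ 1`: two tallies with sum at least `n - 2 f` cannot both stay below `τ`. Hence a solid transaction
is never in a missing pair, and `n - f` voters settle all missing pairs. Within a subdag the final
graph is therefore complete, and its topological order follows reachability (`pairwise_finalize`).
Across subdags, the last retained component contains a solid transaction, which all retained ones
reach and which has an edge's weight over everything not retained so far (`exists_anchor`).

Votes refer to the voter's own list of missing pairs, so agreement is needed. Commit sequences are
comparable (`leaders_prefix_or`), and the timing of parallel tasks is irrelevant because a snapshot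
omits only transactions of earlier graphs (`excluded_subset`, `buildTask_filter`); together they
give `task_agree`. -/

noncomputable section

namespace Herring

/-! ### Strongly connected components under the addition of edges -/

namespace DepGraph

variable {Tx : Type*}

theorem mem_scc {G : DepGraph Tx} {u v : Tx} :
    v ∈ G.scc u ↔ v ∈ G.verts ∧ G.Reaches u v ∧ G.Reaches v u := by
  simp [scc]

theorem self_mem_scc {G : DepGraph Tx} {u : Tx} (hu : u ∈ G.verts) : u ∈ G.scc u :=
  mem_scc.2 ⟨hu, Relation.ReflTransGen.refl, Relation.ReflTransGen.refl⟩

theorem Reaches.of_mem_scc {G : DepGraph Tx} {c u v : Tx} (hu : u ∈ G.scc c) (hv : v ∈ G.scc c) :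
    G.Reaches u v :=
  Relation.ReflTransGen.trans (mem_scc.1 hu).2.2 (mem_scc.1 hv).2.1

theorem scc_congr {G : DepGraph Tx} {u v : Tx} (h : G.Reaches u v) (h' : G.Reaches v u) :
    G.scc u = G.scc v := by
  ext x
  simp only [mem_scc]
  exact ⟨fun ⟨a, b, c⟩ => ⟨a, Relation.ReflTransGen.trans h' b, Relation.ReflTransGen.trans c h⟩,
    fun ⟨a, b, c⟩ => ⟨a, Relation.ReflTransGen.trans h b, Relation.ReflTransGen.trans c h'⟩⟩

/-- A path between two vertices of a component stays in the component. -/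
theorem Reaches.mono_scc {G H : DepGraph Tx} (hG : G.WellFormed) {c u v : Tx}
    (h : ∀ a ∈ G.scc c, ∀ b ∈ G.scc c, (a, b) ∈ G.edges → (a, b) ∈ H.edges)
    (hu : u ∈ G.scc c) (hv : v ∈ G.scc c) : H.Reaches u v := by
  have huv : G.Reaches u v := .of_mem_scc hu hv
  induction huv using Relation.ReflTransGen.head_induction_on with
  | refl => exact Relation.ReflTransGen.refl
  | @head a b hab hbv ih =>
    -- The path continues to `v`, which leads back to `c`, so its next vertex cannot leave the
    -- component.
    have hb : b ∈ G.scc c := by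
      refine mem_scc.2 ⟨(Finset.mem_product.1 (hG hab)).2, ?_, ?_⟩
      · exact Relation.ReflTransGen.tail (mem_scc.1 hu).2.1 hab
      · exact Relation.ReflTransGen.trans hbv (mem_scc.1 hv).2.2
    exact Relation.ReflTransGen.head (h a hu b hb hab) (ih hb)

/-- Adding edges can only merge components. This shows that the anchor, counted before the votes are
added, cuts nothing off the graph completed by votes. -/
theorem IsTopoSort.length_le {G H : DepGraph Tx} (hG : G.WellFormed) {l kept : List (Finset Tx)}
    (hl : H.IsTopoSort l) (hk : ∀ C ∈ kept, ∃ c, C = G.scc c)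
    (hcov : ∀ v ∈ H.verts, ∃ C ∈ kept, v ∈ C)
    (hedges : ∀ C ∈ kept, ∀ a ∈ C, ∀ b ∈ C, (a, b) ∈ G.edges → (a, b) ∈ H.edges) :
    l.length ≤ kept.length := by
  -- A kept component lies in a single component of `H`, so any member determines it; `∅` is a dummy
  -- value.
  let g : Finset Tx → Finset Tx := fun C => if h : C.Nonempty then H.scc h.choose else ∅
  have hsub : l ⊆ kept.map g := by
    intro D hD
    obtain ⟨u, hu, rfl⟩ := (hl.2.1 D).1 hD
    obtain ⟨C, hC, huC⟩ := hcov u hu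
    have hne : C.Nonempty := ⟨u, huC⟩
    refine List.mem_map.2 ⟨C, hC, ?_⟩
    have hch := hne.choose_spec
    simp only [g, dif_pos hne]
    obtain ⟨c, hc⟩ := hk C hC
    have hed := hedges C hC
    generalize hne.choose = x at *
    subst hc
    exact scc_congr (Reaches.mono_scc hG hed hch huC) (Reaches.mono_scc hG hed huC hch)
  simpa using (hl.1.subperm hsub).length_le

end DepGraph

/-! ### List positions, filtering and merging -/

section Lists

variable {α : Type*}

theorem dropWhile_congr {p q : α → Bool} {l : List α} (h : ∀ x ∈ l, p x = q x) :
    l.dropWhile p = l.dropWhile q := by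
  induction l with
  | nil => rfl
  | cons a l ih =>
    simp only [List.dropWhile_cons, h a (by simp), ih fun x hx => h x (by simp [hx])]

theorem rdropWhile_congr {p q : α → Bool} {l : List α} (h : ∀ x ∈ l, p x = q x) :
    l.rdropWhile p = l.rdropWhile q := by
  unfold List.rdropWhile
  rw [dropWhile_congr fun x hx => h x (List.mem_reverse.1 hx)]

/-- No membership is needed: an absent element has the length of the list as its index, before and
after filtering. -/
theorem idxOf_filter_lt_iff [DecidableEq α] {p : α → Bool} {l : List α} {u v : α}
    (hu : p u = true) (hv : p v = true) :
    (l.filter p).idxOf u < (l.filter p).idxOf v ↔ l.idxOf u < l.idxOf v := by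
  induction l with
  | nil => simp
  | cons a l ih =>
    by_cases hau : a = u
    · subst hau
      by_cases hav : a = v
      · subst hav; simp
      · simp [hu, List.idxOf_cons_ne _ hav]
    · by_cases hav : a = v
      · subst hav; simp [hv]
      · by_cases ha : p a = true
        · simp [ha, List.idxOf_cons_ne _ hau, List.idxOf_cons_ne _ hav, ih]
        · simp [ha, List.idxOf_cons_ne _ hau, List.idxOf_cons_ne _ hav, ih]

theorem rel_of_idxOf_lt [DecidableEq α] {R : α → α → Prop} {l : List α} (h : l.Pairwise R)
    {u v : α} (hv : v ∈ l) (huv : l.idxOf u < l.idxOf v) : R u v := by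
  have hv' := List.idxOf_lt_length_iff.2 hv
  have := List.pairwise_iff_getElem.1 h _ _ (huv.trans hv') hv' huv
  simpa using this

theorem exists_ingest_eq [LinearOrder α] (old new : List α) :
    ∃ s, ingest old new = old ++ s ∧ s.Sublist new ∧ (∀ x ∈ s, x ∉ old) ∧
      ∀ x ∈ new, x ∈ old ++ s := by
  induction new generalizing old with
  | nil => exact ⟨[], by simp [ingest]⟩
  | cons a new ih =>
    by_cases ha : a ∈ old
    · obtain ⟨s, h1, h2, h3, h4⟩ := ih old
      refine ⟨s, ?_, h2.cons a, h3, ?_⟩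
      · rw [← h1]; simp [ingest, ha]
      · intro x hx
        rcases List.mem_cons.1 hx with rfl | hx
        · simp [ha]
        · exact h4 x hx
    · obtain ⟨s, h1, h2, h3, h4⟩ := ih (old ++ [a])
      refine ⟨a :: s, ?_, h2.cons_cons a, ?_, ?_⟩
      · have : ingest old (a :: new) = ingest (old ++ [a]) new := by simp [ingest, ha]
        rw [this, h1]; simp
      · intro x hx
        rcases List.mem_cons.1 hx with rfl | hx
        · exact ha
        · exact fun h => h3 x hx (by simp [h])
      · intro x hx
        rcases List.mem_cons.1 hx with rfl | hx
        · simp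
        · simpa using h4 x hx

theorem mem_ingest [LinearOrder α] {old new : List α} {x : α} :
    x ∈ ingest old new ↔ x ∈ old ∨ x ∈ new := by
  obtain ⟨s, h1, h2, -, h4⟩ := exists_ingest_eq old new
  rw [h1]
  constructor
  · intro h
    rcases List.mem_append.1 h with h | h
    · exact .inl h
    · exact .inr (h2.subset h)
  · rintro (h | h)
    · simp [h]
    · exact h4 x h

theorem pairwise_ingest [LinearOrder α] {R : α → α → Prop} {old new : List α}
    (hold : old.Pairwise R) (hnew : new.Pairwise R)
    (h : ∀ a ∈ old, ∀ b ∈ new, b ∉ old → R a b) : (ingest old new).Pairwise R := by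
  obtain ⟨s, h1, h2, h3, -⟩ := exists_ingest_eq old new
  rw [h1, List.pairwise_append]
  exact ⟨hold, hnew.sublist h2, fun a ha b hb => h a ha b (h2.subset hb) (h3 b hb)⟩

end Lists

/-! ### Output order of a complete graph -/

section Routines

variable {Tx : Type*} {P : Params Tx}

theorem Params.tau_pos : 0 < P.tau := by
  unfold Params.tau; omega

theorem Params.lt_tau : P.f < P.tau := by
  unfold Params.tau; omega

/-- In the output order of a complete graph, earlier transactions reach later ones. -/
theorem pairwise_finalize {H : DepGraph Tx} (hH : H.WellFormed)
    (hcomplete : ∀ a ∈ H.verts, ∀ b ∈ H.verts, a ≠ b → (a, b) ∈ H.edges ∨ (b, a) ∈ H.edges)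
    (k : ℕ) : (finalize P H k).Pairwise H.Reaches := by
  have hts := P.topoSort_spec H hH
  have hlin : ∀ C u, u ∈ P.linearize H C → u ∈ C := fun C u h => by
    rw [← (P.linearize_spec H C).2]
    simpa using h
  have hverts : ∀ C ∈ (P.topoSort H).take k, ∀ u ∈ C, u ∈ H.verts := fun C hC u hu => by
    obtain ⟨c, -, rfl⟩ := (hts.2.1 C).1 (List.mem_of_mem_take hC)
    exact (DepGraph.mem_scc.1 hu).1
  unfold finalize
  rw [List.pairwise_flatMap]
  constructor
  · intro C hC
    obtain ⟨c, -, rfl⟩ := (hts.2.1 C).1 (List.mem_of_mem_take hC)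
    exact List.Pairwise.imp_of_mem (R := fun _ _ => True)
      (fun ha hb _ => .of_mem_scc (hlin _ _ ha) (hlin _ _ hb))
      (List.pairwise_of_forall fun _ _ => trivial)
  · refine List.Pairwise.imp_of_mem (fun {C D} hC hD h a ha b hb => ?_)
      (hts.2.2.sublist (List.take_sublist k _))
    have ha := hlin _ _ ha
    have hb := hlin _ _ hb
    rcases eq_or_ne a b with rfl | hab
    · exact Relation.ReflTransGen.refl
    -- A topological order only excludes backward edges; completeness turns this into a forward
    -- edge.
    rcases hcomplete a (hverts C hC a ha) b (hverts D hD b hb) hab with h' | h'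
    · exact Relation.ReflTransGen.single h'
    · exact absurd h' (h a ha b hb)

end Routines

/-! ### Graph construction: thresholds, anchor, irrelevance of omitted transactions -/

section Task

variable {Tx : Type*} [LinearOrder Tx] {P : Params Tx}

theorem mem_pairs {W : Finset Tx} {a b : Tx} : (a, b) ∈ pairs W ↔ a ∈ W ∧ b ∈ W ∧ a < b := by
  simp [pairs, and_assoc]

theorem of_mem_tallyEdges {w : Tx → Tx → ℕ} {S : Finset (Tx × Tx)} {a b : Tx}
    (h : (a, b) ∈ tallyEdges P w S) : P.tau ≤ w a b ∧ ((a, b) ∈ S ∨ (b, a) ∈ S) := by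
  simp only [tallyEdges, Finset.mem_image, Finset.mem_filter] at h
  obtain ⟨⟨x, y⟩, ⟨hS, hmax⟩, hp⟩ := h
  split_ifs at hp with hle <;> simp only [Prod.mk.injEq] at hp hle hmax <;>
    obtain ⟨rfl, rfl⟩ := hp
  · exact ⟨by rwa [max_eq_left hle] at hmax, .inl hS⟩
  · exact ⟨by rwa [max_eq_right (not_le.1 hle).le] at hmax, .inr hS⟩

theorem mem_tallyEdges_or {w : Tx → Tx → ℕ} {S : Finset (Tx × Tx)} {a b : Tx} (h : (a, b) ∈ S)
    (hmax : P.tau ≤ max (w a b) (w b a)) :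
    (a, b) ∈ tallyEdges P w S ∨ (b, a) ∈ tallyEdges P w S := by
  simp only [tallyEdges, Finset.mem_image, Finset.mem_filter]
  by_cases hle : w b a ≤ w a b
  · exact .inl ⟨(a, b), ⟨h, hmax⟩, by simp [hle]⟩
  · exact .inr ⟨(a, b), ⟨h, hmax⟩, by simp [hle]⟩

theorem tallyEdges_congr {w w' : Tx → Tx → ℕ} {S : Finset (Tx × Tx)}
    (h : ∀ a b, (a, b) ∈ S → w a b = w' a b ∧ w b a = w' b a) :
    tallyEdges P w S = tallyEdges P w' S := by
  have h1 : S.filter (fun p => P.tau ≤ max (w p.1 p.2) (w p.2 p.1)) =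
      S.filter (fun p => P.tau ≤ max (w' p.1 p.2) (w' p.2 p.1)) :=
    Finset.filter_congr fun p hp => by rw [(h p.1 p.2 hp).1, (h p.1 p.2 hp).2]
  unfold tallyEdges
  rw [h1]
  refine Finset.image_congr fun p hp => ?_
  have hp := (Finset.mem_filter.1 (Finset.mem_coe.1 hp)).1
  simp only [(h p.1 p.2 hp).1, (h p.1 p.2 hp).2]

theorem placesBefore_or {L : List Tx} {u v : Tx} (huv : u ≠ v) (hu : u ∈ L) :
    PlacesBefore L u v ∨ PlacesBefore L v u := by
  by_cases hv : v ∈ L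
  · rcases lt_trichotomy (L.idxOf u) (L.idxOf v) with h | h | h
    · exact .inl ⟨hu, fun _ => h⟩
    · exact absurd ((List.idxOf_inj hu).1 h) huv
    · exact .inr ⟨hv, fun _ => h⟩
  · exact .inl ⟨hu, fun h => absurd h hv⟩

theorem support_le_weight_add_weight (L : Fin P.n → List Tx) {u v : Tx} (huv : u ≠ v) :
    support P L u ≤ weight P L u v + weight P L v u := by
  refine le_trans (Finset.card_le_card ?_) (Finset.card_union_le _ _)
  intro i hi
  simp only [Finset.mem_filter, Finset.mem_univ, true_and, Finset.mem_union] at hi ⊢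
  exact placesBefore_or huv hi

/-- A list with `u` but without `v` counts as placing `u` first. This handles blank `v`, which have
no vertex in the graph. -/
theorem support_le_weight_add_support (L : Fin P.n → List Tx) (u v : Tx) :
    support P L u ≤ weight P L u v + support P L v := by
  refine le_trans (Finset.card_le_card ?_) (Finset.card_union_le _ _)
  intro i hi
  simp only [Finset.mem_filter, Finset.mem_univ, true_and, Finset.mem_union] at hi ⊢
  by_cases hv : v ∈ L i
  · exact .inr hv
  · exact .inl ⟨hi, fun h => absurd h hv⟩

theorem mem_appearing {L : Fin P.n → List Tx} {u : Tx} : u ∈ appearing P L ↔ ∃ i, u ∈ L i := by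
  simp [appearing]

theorem mem_appearing_of_support_pos {L : Fin P.n → List Tx} {u : Tx} (h : 0 < support P L u) :
    u ∈ appearing P L := by
  obtain ⟨i, hi⟩ := Finset.card_pos.1 h
  exact mem_appearing.2 ⟨i, (Finset.mem_filter.1 hi).2⟩

theorem mem_solids {L : Fin P.n → List Tx} {u : Tx} :
    u ∈ solids P L ↔ u ∈ appearing P L ∧ P.tauSolid ≤ support P L u := by
  simp [solids]

/-- The non-blank transactions that no earlier graph contains. -/
def freshVerts (L : Fin P.n → List Tx) (prior : Finset Tx) : Finset Tx :=
  (appearing P L).filter (fun tx => P.tau ≤ support P L tx) \ prior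

/-- The dependency graph before truncation. -/
def fullGraph (L : Fin P.n → List Tx) (prior : Finset Tx) : DepGraph Tx :=
  ⟨freshVerts L prior, tallyEdges P (weight P L) (pairs (freshVerts L prior))⟩

/-- The components that survive truncation. -/
def keptComponents (L : Fin P.n → List Tx) (prior : Finset Tx) : List (Finset Tx) :=
  (P.topoSort (fullGraph L prior)).rdropWhile (fun C => decide (Disjoint C (solids P L)))

/-- The transactions that survive truncation. -/
def keptVerts (L : Fin P.n → List Tx) (prior : Finset Tx) : Finset Tx :=
  (freshVerts L prior).filter (fun tx => ∃ C ∈ keptComponents L prior, tx ∈ C)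

theorem mem_freshVerts {L : Fin P.n → List Tx} {prior : Finset Tx} {u : Tx} :
    u ∈ freshVerts L prior ↔ P.tau ≤ support P L u ∧ u ∉ prior := by
  simp only [freshVerts, Finset.mem_sdiff, Finset.mem_filter]
  exact ⟨fun h => ⟨h.1.2, h.2⟩, fun h =>
    ⟨⟨mem_appearing_of_support_pos (Params.tau_pos.trans_le h.1), h.1⟩, h.2⟩⟩

theorem mem_keptVerts {L : Fin P.n → List Tx} {prior : Finset Tx} {u : Tx} :
    u ∈ keptVerts L prior ↔ u ∈ freshVerts L prior ∧ ∃ C ∈ keptComponents L prior, u ∈ C := by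
  simp [keptVerts]

theorem buildTask_graph (L : Fin P.n → List Tx) (prior : Finset Tx) :
    (buildTask P L prior).graph = (fullGraph L prior).restrict (keptVerts L prior) := rfl

theorem buildTask_missing (L : Fin P.n → List Tx) (prior : Finset Tx) :
    (buildTask P L prior).missing =
      ((pairs (freshVerts L prior)).filter
        (fun p => max (weight P L p.1 p.2) (weight P L p.2 p.1) < P.tau)).filter
        (fun p => p.1 ∈ keptVerts L prior ∧ p.2 ∈ keptVerts L prior) := rfl

theorem buildTask_solid (L : Fin P.n → List Tx) (prior : Finset Tx) :
    (buildTask P L prior).solid = solids P L := rfl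

theorem buildTask_anchor (L : Fin P.n → List Tx) (prior : Finset Tx) :
    (buildTask P L prior).anchor = (keptComponents L prior).length := rfl

theorem buildTask_verts (L : Fin P.n → List Tx) (prior : Finset Tx) :
    (buildTask P L prior).graph.verts = keptVerts L prior := by
  ext u
  simp only [buildTask_graph, DepGraph.restrict, Finset.mem_inter]
  exact ⟨fun h => h.2, fun h => ⟨(mem_keptVerts.1 h).1, h⟩⟩

theorem tallyEdges_wellFormed {w : Tx → Tx → ℕ} {S : Finset (Tx × Tx)} {K : Finset Tx}
    (hS : ∀ a b, (a, b) ∈ S → a ∈ K ∧ b ∈ K) : tallyEdges P w S ⊆ K ×ˢ K := by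
  rintro ⟨a, b⟩ h
  rcases (of_mem_tallyEdges h).2 with h | h
  · exact Finset.mem_product.2 (hS a b h)
  · exact Finset.mem_product.2 (hS b a h).symm

theorem fullGraph_wellFormed (L : Fin P.n → List Tx) (prior : Finset Tx) :
    (fullGraph L prior).WellFormed :=
  tallyEdges_wellFormed fun _ _ h => ⟨(mem_pairs.1 h).1, (mem_pairs.1 h).2.1⟩

theorem buildTask_wellFormed (L : Fin P.n → List Tx) (prior : Finset Tx) :
    (buildTask P L prior).graph.WellFormed := by
  rintro ⟨a, b⟩ h
  rw [buildTask_verts]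
  simp only [buildTask_graph, DepGraph.restrict, Finset.mem_filter] at h
  exact Finset.mem_product.2 h.2

theorem mem_buildTask_missing {L : Fin P.n → List Tx} {prior : Finset Tx} {a b : Tx} :
    (a, b) ∈ (buildTask P L prior).missing ↔ a ∈ keptVerts L prior ∧ b ∈ keptVerts L prior ∧
      a < b ∧ max (weight P L a b) (weight P L b a) < P.tau := by
  simp only [buildTask_missing, Finset.mem_filter, mem_pairs]
  constructor
  · rintro ⟨⟨⟨-, -, h⟩, h'⟩, ha, hb⟩
    exact ⟨ha, hb, h, h'⟩
  · rintro ⟨ha, hb, h, h'⟩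
    exact ⟨⟨⟨(mem_keptVerts.1 ha).1, (mem_keptVerts.1 hb).1, h⟩, h'⟩, ha, hb⟩

theorem fullGraph_edge_or {L : Fin P.n → List Tx} {prior : Finset Tx} {a b : Tx}
    (ha : a ∈ freshVerts L prior) (hb : b ∈ freshVerts L prior) (hab : a ≠ b)
    (hmax : P.tau ≤ max (weight P L a b) (weight P L b a)) :
    (a, b) ∈ (fullGraph L prior).edges ∨ (b, a) ∈ (fullGraph L prior).edges := by
  rcases lt_or_gt_of_ne hab with h | h
  · exact mem_tallyEdges_or (mem_pairs.2 ⟨ha, hb, h⟩) hmax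
  · exact (mem_tallyEdges_or (mem_pairs.2 ⟨hb, ha, h⟩) (by rwa [max_comm])).symm

theorem of_mem_fullGraph_edges {L : Fin P.n → List Tx} {prior : Finset Tx} {a b : Tx}
    (h : (a, b) ∈ (fullGraph L prior).edges) : a ≠ b ∧ P.tau ≤ weight P L a b := by
  obtain ⟨h1, h2⟩ := of_mem_tallyEdges h
  refine ⟨?_, h1⟩
  rcases h2 with h | h
  · exact (mem_pairs.1 h).2.2.ne
  · exact (mem_pairs.1 h).2.2.ne'

theorem of_mem_buildTask_edges {L : Fin P.n → List Tx} {prior : Finset Tx} {a b : Tx}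
    (h : (a, b) ∈ (buildTask P L prior).graph.edges) : a ≠ b ∧ P.tau ≤ weight P L a b := by
  simp only [buildTask_graph, DepGraph.restrict, Finset.mem_filter] at h
  exact of_mem_fullGraph_edges h.1

theorem buildTask_edge_or {L : Fin P.n → List Tx} {prior : Finset Tx} {a b : Tx}
    (ha : a ∈ (buildTask P L prior).graph.verts) (hb : b ∈ (buildTask P L prior).graph.verts)
    (hab : a < b) :
    (a, b) ∈ (buildTask P L prior).graph.edges ∨ (b, a) ∈ (buildTask P L prior).graph.edges ∨
      (a, b) ∈ (buildTask P L prior).missing := by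
  rw [buildTask_verts] at ha hb
  by_cases hmax : P.tau ≤ max (weight P L a b) (weight P L b a)
  · simp only [buildTask_graph, DepGraph.restrict, Finset.mem_filter]
    rcases fullGraph_edge_or (mem_keptVerts.1 ha).1 (mem_keptVerts.1 hb).1 hab.ne hmax with h | h
    · exact .inl ⟨h, ha, hb⟩
    · exact .inr (.inl ⟨h, hb, ha⟩)
  · exact .inr (.inr (mem_buildTask_missing.2 ⟨ha, hb, hab, not_le.1 hmax⟩))

theorem mem_topoSort_fullGraph {L : Fin P.n → List Tx} {prior : Finset Tx} {v : Tx}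
    (hv : v ∈ freshVerts L prior) :
    ∃ C ∈ P.topoSort (fullGraph L prior), v ∈ C :=
  ⟨_, ((P.topoSort_spec _ (fullGraph_wellFormed L prior)).2.1 _).2 ⟨v, hv, rfl⟩,
    DepGraph.self_mem_scc hv⟩

theorem keptComponents_scc {L : Fin P.n → List Tx} {prior : Finset Tx} {C : Finset Tx}
    (hC : C ∈ keptComponents L prior) : ∃ u ∈ freshVerts L prior, C = (fullGraph L prior).scc u :=
  ((P.topoSort_spec _ (fullGraph_wellFormed L prior)).2.1 C).1
    ((List.rdropWhile_prefix _ _).subset hC)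

/-- The two weights sum to at least `n - 2 f ≥ 2 τ - 1`, so one of them reaches `τ`. The hypothesis
`hP` is the integral form in which the bound on `n` is used throughout. -/
theorem tau_le_max_weight {L : Fin P.n → List Tx} {z v : Tx} (hP : 2 * P.tau + 2 * P.f ≤ P.n + 1)
    (hz : P.tauSolid ≤ support P L z) (hzv : z ≠ v) :
    P.tau ≤ max (weight P L z v) (weight P L v z) := by
  have h1 := support_le_weight_add_weight L hzv
  have h2 := le_max_left (weight P L z v) (weight P L v z)
  have h3 := le_max_right (weight P L z v) (weight P L v z)
  unfold Params.tauSolid at hz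
  omega

/-- A non-empty truncated graph has an anchor: every retained transaction reaches it, and it
precedes all transactions that have never been retained. -/
theorem exists_anchor {L : Fin P.n → List Tx} {prior : Finset Tx}
    (hP : 2 * P.tau + 2 * P.f ≤ P.n + 1) {u : Tx}
    (hu : u ∈ (buildTask P L prior).graph.verts) :
    ∃ z, (∀ v ∈ (buildTask P L prior).graph.verts, (fullGraph L prior).Reaches v z) ∧
      ∀ v ∉ prior, v ∉ (buildTask P L prior).graph.verts → z ≠ v ∧ P.tau ≤ weight P L z v := by
  rw [buildTask_verts] at hu ⊢
  obtain ⟨-, C₀, hC₀, -⟩ := mem_keptVerts.1 hu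
  have hne : keptComponents L prior ≠ [] := List.ne_nil_of_mem hC₀
  have hlast : ¬ decide (Disjoint ((keptComponents L prior).getLast hne) (solids P L)) = true :=
    List.rdropWhile_last_not _ _ hne
  have hts := P.topoSort_spec _ (fullGraph_wellFormed L prior)
  obtain ⟨init, D, hkept⟩ : ∃ init D, keptComponents L prior = init ++ [D] :=
    ⟨_, _, (List.dropLast_append_getLast hne).symm⟩
  obtain ⟨rest, hrest⟩ : keptComponents L prior <+: P.topoSort (fullGraph L prior) :=
    List.rdropWhile_prefix _ _
  have hD : ¬ Disjoint D (solids P L) := by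
    simpa [hkept] using hlast
  -- Truncation stops at a component `D` with a solid member; this is the anchor. An edge joins it
  -- to every other vertex, and the position of `D` dictates the direction: from earlier components
  -- into `z`, from `z` to the components cut off.
  obtain ⟨z, hzD, hzS⟩ := Finset.not_disjoint_iff.1 hD
  have hzK : z ∈ keptVerts L prior := by
    obtain ⟨c, -, hc⟩ := keptComponents_scc (show D ∈ keptComponents L prior by simp [hkept])
    refine mem_keptVerts.2 ⟨?_, D, by simp [hkept], hzD⟩
    rw [hc] at hzD
    exact (DepGraph.mem_scc.1 hzD).1
  have hzW := (mem_keptVerts.1 hzK).1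
  have hz := (mem_solids.1 hzS).2
  have hpw := hts.2.2
  rw [← hrest, hkept] at hpw
  rw [List.pairwise_append, List.pairwise_append] at hpw
  refine ⟨z, fun v hv => ?_, fun v hv hvK => ?_⟩
  · rcases eq_or_ne z v with rfl | hzv
    · exact Relation.ReflTransGen.refl
    obtain ⟨hvW, C, hC, hvC⟩ := mem_keptVerts.1 hv
    rcases fullGraph_edge_or hzW hvW hzv (tau_le_max_weight hP hz hzv) with h | h
    · rw [hkept] at hC
      rcases List.mem_append.1 hC with hC' | hC'
      · exact absurd h (hpw.1.2.2 C hC' D (by simp) v hvC z hzD)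
      · rw [List.mem_singleton] at hC'
        subst hC'
        obtain ⟨c, -, rfl⟩ := keptComponents_scc (show C ∈ keptComponents L prior by simp [hkept])
        exact .of_mem_scc hvC hzD
    · exact Relation.ReflTransGen.single h
  · have hzv : z ≠ v := fun h => hvK (h ▸ hzK)
    refine ⟨hzv, ?_⟩
    by_cases hvW : v ∈ freshVerts L prior
    · rcases fullGraph_edge_or hzW hvW hzv (tau_le_max_weight hP hz hzv) with h | h
      · exact (of_mem_fullGraph_edges h).2
      · obtain ⟨C, hC, hvC⟩ := mem_topoSort_fullGraph hvW
        rw [← hrest] at hC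
        rcases List.mem_append.1 hC with hC | hC
        · exact absurd (mem_keptVerts.2 ⟨hvW, C, hC, hvC⟩) hvK
        · exact absurd h (hpw.2.2 D (by simp) C hC z hzD v hvC)
    -- Here `v` is blank: at least `(n - 2 f) - (τ - 1) ≥ τ` lists contain `z` but not `v`.
    · have hsupp : support P L v < P.tau := by
        by_contra hcon
        exact hvW (mem_freshVerts.2 ⟨not_lt.1 hcon, hv⟩)
      have := support_le_weight_add_support L z v
      unfold Params.tauSolid at hz
      omega

theorem mem_rdropWhile_of_not {α : Type*} {p : α → Bool} {l : List α} {x : α} (hx : x ∈ l)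
    (hp : p x = false) : x ∈ l.rdropWhile p := by
  unfold List.rdropWhile
  rw [List.mem_reverse]
  have hx' := List.mem_reverse.2 hx
  rw [← List.takeWhile_append_dropWhile (p := p) (l := l.reverse)] at hx'
  rcases List.mem_append.1 hx' with h | h
  · have := List.mem_takeWhile_imp h
    simp [hp] at this
  · exact h

/-- Since `n - 2 f ≥ τ`, a solid transaction outside `prior` is a vertex, and truncation spares its
component. Omitting the solid claims of a task in flight thus omits nothing that is not already
retained somewhere. -/
theorem buildTask_solid_subset {L : Fin P.n → List Tx} {prior : Finset Tx}
    (hP : 2 * P.tau + 2 * P.f ≤ P.n + 1) :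
    (buildTask P L prior).solid ⊆ (buildTask P L prior).graph.verts ∪ prior := by
  intro u hu
  rw [buildTask_verts, Finset.mem_union]
  rw [buildTask_solid] at hu
  by_cases hup : u ∈ prior
  · exact .inr hup
  have hs := (mem_solids.1 hu).2
  have hW : u ∈ freshVerts L prior := by
    refine mem_freshVerts.2 ⟨?_, hup⟩
    have := Params.lt_tau (P := P)
    unfold Params.tauSolid at hs
    omega
  obtain ⟨C, hC, huC⟩ := mem_topoSort_fullGraph hW
  refine .inl (mem_keptVerts.2 ⟨hW, C, mem_rdropWhile_of_not hC ?_, huC⟩)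
  simp only [decide_eq_false_iff_not, Finset.not_disjoint_iff]
  exact ⟨u, huC, hu⟩

/-- Dropping transactions of `prior` from the orderings changes neither the graph nor the set of
missing pairs nor the anchor. -/
theorem buildTask_filter {L : Fin P.n → List Tx} {prior X : Finset Tx} (hX : X ⊆ prior) :
    let T := buildTask P (fun i => (L i).filter (fun tx => decide (tx ∉ X))) prior
    T.graph = (buildTask P L prior).graph ∧ T.missing = (buildTask P L prior).missing ∧
      T.anchor = (buildTask P L prior).anchor := by
  intro T
  set L' : Fin P.n → List Tx := fun i => (L i).filter (fun tx => decide (tx ∉ X)) with hL'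
  have hmem : ∀ u ∉ prior, ∀ i, u ∈ L' i ↔ u ∈ L i := fun u hu i => by
    simpa [hL'] using fun _ h => hu (hX h)
  have hsup : ∀ u ∉ prior, support P L' u = support P L u := fun u hu => by
    unfold support
    exact congrArg _ (Finset.filter_congr fun i _ => hmem u hu i)
  have hwt : ∀ u ∉ prior, ∀ v ∉ prior, weight P L' u v = weight P L u v := fun u hu v hv => by
    unfold weight
    refine congrArg _ (Finset.filter_congr fun i _ => ?_)
    unfold PlacesBefore
    rw [hmem u hu, hmem v hv]
    have hidx : (L' i).idxOf u < (L' i).idxOf v ↔ (L i).idxOf u < (L i).idxOf v :=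
      idxOf_filter_lt_iff (by simpa using fun h => hu (hX h)) (by simpa using fun h => hv (hX h))
    rw [hidx]
  have hW : freshVerts L' prior = freshVerts L prior := by
    ext u
    simp only [mem_freshVerts]
    exact and_congr_left fun hu => by rw [hsup u hu]
  have hpr : ∀ u ∈ freshVerts L prior, u ∉ prior := fun u hu => (mem_freshVerts.1 hu).2
  have hG : fullGraph L' prior = fullGraph L prior := by
    unfold fullGraph
    rw [hW]
    congr 1
    refine tallyEdges_congr fun a b hab => ?_
    obtain ⟨ha, hb, -⟩ := mem_pairs.1 hab
    exact ⟨hwt _ (hpr _ ha) _ (hpr _ hb), hwt _ (hpr _ hb) _ (hpr _ ha)⟩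
  have hkept : keptComponents L' prior = keptComponents L prior := by
    unfold keptComponents
    rw [hG]
    -- The set of solid transactions may shrink, but only inside `prior`, and components contain no
    -- member of `prior`.
    refine rdropWhile_congr fun C hC => ?_
    obtain ⟨c, -, rfl⟩ := ((P.topoSort_spec _ (fullGraph_wellFormed L prior)).2.1 C).1 hC
    rw [decide_eq_decide]
    simp only [Finset.disjoint_left]
    refine forall₂_congr fun u hu => not_congr ?_
    have hup := hpr u (DepGraph.mem_scc.1 hu).1
    simp only [mem_solids, mem_appearing, hsup u hup, hmem u hup]
  have hK : keptVerts L' prior = keptVerts L prior := by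
    unfold keptVerts
    rw [hW, hkept]
  refine ⟨?_, ?_, ?_⟩
  · rw [buildTask_graph, buildTask_graph, hG, hK]
  · ext ⟨a, b⟩
    rw [mem_buildTask_missing, mem_buildTask_missing, hK]
    refine and_congr_right fun ha => and_congr_right fun hb => ?_
    have ha := hpr a (mem_keptVerts.1 ha).1
    have hb := hpr b (mem_keptVerts.1 hb).1
    rw [hwt a ha b hb, hwt b hb a ha]
  · rw [buildTask_anchor, buildTask_anchor, hkept]

/-- The transactions of the graph `H`, which extends a truncated graph, are all output. -/
theorem mem_finalize {L : Fin P.n → List Tx} {prior : Finset Tx} {H : DepGraph Tx}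
    (hH : H.WellFormed) (hverts : H.verts = (buildTask P L prior).graph.verts)
    (hedges : (buildTask P L prior).graph.edges ⊆ H.edges) {u : Tx} :
    u ∈ finalize P H (buildTask P L prior).anchor ↔ u ∈ H.verts := by
  have hts := P.topoSort_spec H hH
  have hlen : (P.topoSort H).length ≤ (buildTask P L prior).anchor := by
    rw [buildTask_anchor]
    rw [buildTask_verts] at hverts
    refine hts.length_le (fullGraph_wellFormed L prior)
      (fun C hC => (keptComponents_scc hC).imp fun _ h => h.2) (fun v hv => ?_) ?_
    · rw [hverts] at hv
      exact (mem_keptVerts.1 hv).2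
    · intro C hC a ha b hb hab
      have hsub : ∀ x ∈ C, x ∈ keptVerts L prior := fun x hx => by
        obtain ⟨c, -, hc⟩ := keptComponents_scc hC
        refine mem_keptVerts.2 ⟨?_, C, hC, hx⟩
        rw [hc] at hx
        exact (DepGraph.mem_scc.1 hx).1
      apply hedges
      simp only [buildTask_graph, DepGraph.restrict, Finset.mem_filter]
      exact ⟨hab, hsub a ha, hsub b hb⟩
  unfold finalize
  rw [List.take_of_length_le hlen, List.mem_flatMap]
  have hlin : ∀ C, u ∈ P.linearize H C ↔ u ∈ C := fun C => by
    conv_rhs => rw [← (P.linearize_spec H C).2]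
    simp
  constructor
  · rintro ⟨C, hC, hu⟩
    obtain ⟨c, -, rfl⟩ := (hts.2.1 C).1 hC
    exact (DepGraph.mem_scc.1 ((hlin _).1 hu)).1
  · intro hu
    exact ⟨_, (hts.2.1 _).2 ⟨u, hu, rfl⟩, (hlin _).2 (DepGraph.self_mem_scc hu)⟩

theorem applyFairUpdate_wellFormed (L : Fin P.n → List Tx) (prior : Finset Tx)
    (vts : Fin P.n → Finset (Tx × Tx)) :
    (applyFairUpdate P (buildTask P L prior) vts).WellFormed := by
  unfold DepGraph.WellFormed applyFairUpdate
  refine Finset.union_subset (buildTask_wellFormed L prior) (tallyEdges_wellFormed fun a b h => ?_)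
  rw [buildTask_verts]
  exact ⟨(mem_buildTask_missing.1 h).1, (mem_buildTask_missing.1 h).2.1⟩

end Task

end Herring

end

noncomputable section

namespace Herring

namespace Trace

/-! ### Histories, subdags and reported transactions -/

section Basics

variable {Tx : Type*} {P : Params Tx} {V : Type*} {E : Trace P V}

theorem card_inter_ge {Q Q' : Finset (Fin P.n)} : Q.card + Q'.card ≤ (Q ∩ Q').card + P.n := by
  have h1 := Finset.card_union_add_card_inter Q Q'
  have h2 : (Q ∪ Q').card ≤ P.n := by simpa using Finset.card_le_univ (Q ∪ Q')
  omega

theorem mem_history_self (v : V) : v ∈ E.history v := by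
  unfold history
  cases E.round v <;> simp [historyUpTo]

theorem leaderIn_eq_some {S : Finset V} {w : ℕ} {v : V} (h : E.leaderIn S w = some v) :
    v ∈ S ∧ E.IsLeader w v := by
  unfold leaderIn at h
  split_ifs at h with hex
  simp only [Option.some.injEq] at h
  exact h ▸ hex.choose_spec

theorem subdag_append (ls x : List V) {r : ℕ} (hr : r < ls.length) :
    E.subdag (ls ++ x) r = E.subdag ls r := by
  unfold subdag
  rw [List.getElem?_append_left hr, List.take_append_of_le_length hr.le]

/-- A vertex falls into the subdag of the first leader whose history contains it. Subdags can thus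
be traded for histories, which are causally closed. -/
theorem mem_biUnion_subdag {ls : List V} {r : ℕ} (hr : r ≤ ls.length) {u : V} :
    (∃ k < r, u ∈ E.subdag ls k) ↔ ∃ v ∈ ls.take r, u ∈ E.history v := by
  have hsub : ∀ k, (hk : k < ls.length) → (u ∈ E.subdag ls k ↔
      u ∈ E.history ls[k] ∧ ∀ v ∈ ls.take k, u ∉ E.history v) := fun k hk => by
    unfold subdag
    rw [List.getElem?_eq_getElem hk]
    simp
  induction r with
  | zero => simp
  | succ r ih =>
    have hr' : r < ls.length := hr
    have ih := ih hr'.le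
    rw [← List.take_concat_get' ls r hr']
    constructor
    · rintro ⟨k, hk, hu⟩
      rcases (Nat.lt_succ_iff_lt_or_eq.1 hk) with h | rfl
      · obtain ⟨v, hv, huv⟩ := ih.1 ⟨k, h, hu⟩
        exact ⟨v, List.mem_append_left _ hv, huv⟩
      · exact ⟨_, List.mem_append_right _ (List.mem_singleton.2 rfl), ((hsub k hr').1 hu).1⟩
    · rintro ⟨v, hv, huv⟩
      by_cases h : ∃ v ∈ ls.take r, u ∈ E.history v
      · obtain ⟨k, hk, hu⟩ := ih.2 h
        exact ⟨k, hk.trans (Nat.lt_succ_self r), hu⟩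
      · rcases List.mem_append.1 hv with hv | hv
        · exact absurd ⟨v, hv, huv⟩ h
        · rw [List.mem_singleton] at hv
          subst hv
          exact ⟨r, Nat.lt_succ_self r, (hsub r hr').2 ⟨huv, fun v hv hu => h ⟨v, hv, hu⟩⟩⟩

theorem mem_contribution {A : Finset V} {j : Fin P.n} {x : Tx} :
    x ∈ E.contribution A j ↔ ∃ v ∈ A, E.author v = j ∧ ∃ e ∈ E.entries v, e.1 = x := by
  unfold contribution
  simp only [List.mem_map, List.mem_mergeSort, List.mem_flatMap, Finset.mem_toList,
    Finset.mem_filter]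
  constructor
  · rintro ⟨e, ⟨v, ⟨hv, ha⟩, he⟩, rfl⟩
    exact ⟨v, hv, ha, e, he, rfl⟩
  · rintro ⟨v, hv, ha, e, he, rfl⟩
    exact ⟨e, ⟨v, ⟨hv, ha⟩, he⟩, rfl⟩

theorem pairwise_contribution {A : Finset V} {j : Fin P.n}
    (hA : ∀ v ∈ A, E.author v = j → ∀ e ∈ E.entries v, E.recv j e.1 = (e.2 : ℕ∞)) :
    (E.contribution A j).Pairwise (fun a b => E.recv j a ≤ E.recv j b) := by
  unfold contribution
  rw [List.pairwise_map]
  refine List.Pairwise.imp_of_mem (fun {a b} ha hb h => ?_)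
    (List.pairwise_mergeSort (le := fun a b : Tx × ℕ => decide (a.2 ≤ b.2)) ?_ ?_ _)
  · simp only [List.mem_mergeSort, List.mem_flatMap, Finset.mem_toList, Finset.mem_filter] at ha hb
    obtain ⟨v, ⟨hv, hva⟩, hav⟩ := ha
    obtain ⟨v', ⟨hv', hva'⟩, hbv⟩ := hb
    rw [hA v hv hva a hav, hA v' hv' hva' b hbv]
    exact_mod_cast of_decide_eq_true h
  · intro a b c hab hbc
    simp only [decide_eq_true_eq] at *
    omega
  · intro a b
    simp only [Bool.or_eq_true, decide_eq_true_eq]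
    omega

end Basics

/-! ### Agreement on the sequence of committed leaders -/

section Consensus

variable {Tx : Type*} [LinearOrder Tx] {P : Params Tx} {V : Type*} {E : Trace P V}

theorem card_le_inter_correct (hE : E.IsExecution) {Q : Finset (Fin P.n)} {k : ℕ}
    (hQ : k ≤ Q.card) : k - P.f ≤ (Q ∩ E.correct).card := by
  have h1 := Finset.card_sdiff_add_card_inter Q E.correct
  have h2 : (Q \ E.correct).card ≤ (Finset.univ \ E.correct).card :=
    Finset.card_le_card (Finset.sdiff_subset_sdiff (Finset.subset_univ _) subset_rfl)
  have := hE.byzantine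
  omega

theorem Certified.exists_correct (hE : E.IsExecution) (hn : 4 * P.f < P.n) {v : V}
    (hv : E.Certified v) : ∃ j ∈ E.correct, E.signed j v := by
  obtain ⟨Q, hQ, hs⟩ := hv
  have := card_le_inter_correct hE hQ
  obtain ⟨j, hj⟩ := Finset.card_pos.1 (show 0 < (Q ∩ E.correct).card by omega)
  exact ⟨j, (Finset.mem_inter.1 hj).2, hs j (Finset.mem_inter.1 hj).1⟩

/-- Two quorums of size `n - f` share at least `n - 2 f > f` replicas, hence a correct one, which
signs only one vertex per author and round. -/
theorem Certified.unique (hE : E.IsExecution) (hn : 4 * P.f < P.n) {v v' : V}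
    (hv : E.Certified v) (hv' : E.Certified v') (ha : E.author v = E.author v')
    (hr : E.round v = E.round v') : v = v' := by
  obtain ⟨Q, hQ, hs⟩ := hv
  obtain ⟨Q', hQ', hs'⟩ := hv'
  have h1 := card_inter_ge (Q := Q) (Q' := Q')
  have h2 := card_le_inter_correct hE (le_refl (Q ∩ Q').card)
  obtain ⟨j, hj⟩ := Finset.card_pos.1 (show 0 < ((Q ∩ Q') ∩ E.correct).card by omega)
  simp only [Finset.mem_inter] at hj
  exact hE.signed_unique j hj.2 v v' (hs j hj.1.1) (hs' j hj.1.2) ha hr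

theorem Certified.proposal (hE : E.IsExecution) (hn : 4 * P.f < P.n) {v : V}
    (hv : E.Certified v) (ha : E.author v ∈ E.correct) :
    E.proposal (E.author v) (E.round v) = some v := by
  obtain ⟨j, hj, hs⟩ := hv.exists_correct hE hn
  exact hE.signed_authentic j hj v hs ha

theorem Certified.parent (hE : E.IsExecution) (hn : 4 * P.f < P.n) {u v : V}
    (hv : E.Certified v) (hu : u ∈ E.parents v) : E.round u + 1 = E.round v ∧ E.Certified u := by
  obtain ⟨j, hj, hs⟩ := hv.exists_correct hE hn
  by_cases h0 : E.round v = 0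
  · rw [hE.signed_first j hj v hs h0] at hu
    simp at hu
  · exact (hE.signed_valid j hj v hs h0).1 u hu

theorem Certified.card_parents (hE : E.IsExecution) (hn : 4 * P.f < P.n) {v : V}
    (hv : E.Certified v) (h0 : E.round v ≠ 0) :
    P.n - P.f ≤ ((E.parents v).image E.author).card := by
  obtain ⟨j, hj, hs⟩ := hv.exists_correct hE hn
  exact (hE.signed_valid j hj v hs h0).2

/-- References lower the round by one and end at round `0`, so the bound `round v` on the depth
never cuts a history short. -/
theorem Certified.mem_history_iff (hE : E.IsExecution) (hn : 4 * P.f < P.n) {u v : V}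
    (hv : E.Certified v) : u ∈ E.history v ↔ u = v ∨ ∃ x ∈ E.parents v, u ∈ E.history x := by
  unfold history
  obtain ⟨k, hk⟩ : ∃ k, E.round v = k := ⟨_, rfl⟩
  cases k with
  | zero =>
    have hp : E.parents v = ∅ := by
      obtain ⟨j, hj, hs⟩ := hv.exists_correct hE hn
      exact hE.signed_first j hj v hs hk
    simp [hk, historyUpTo, hp]
  | succ k =>
    simp only [hk, historyUpTo, Finset.mem_insert, Finset.mem_biUnion]
    refine or_congr_right (exists_congr fun x => and_congr_right fun hx => ?_)
    have := (hv.parent hE hn hx).1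
    rw [show E.round x = k by omega]

theorem Certified.of_mem_history (hE : E.IsExecution) (hn : 4 * P.f < P.n) {u v : V}
    (hv : E.Certified v) (hu : u ∈ E.history v) : E.Certified u ∧ E.history u ⊆ E.history v := by
  obtain ⟨k, hk⟩ : ∃ k, E.round v = k := ⟨_, rfl⟩
  induction k using Nat.strong_induction_on generalizing v with
  | _ k ih =>
    rcases (hv.mem_history_iff hE hn).1 hu with rfl | ⟨x, hx, hux⟩
    · exact ⟨hv, subset_rfl⟩
    · obtain ⟨hr, hxc⟩ := hv.parent hE hn hx
      obtain ⟨h1, h2⟩ := ih (E.round x) (by omega) hxc hux rfl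
      exact ⟨h1, fun y hy => (hv.mem_history_iff hE hn).2 (.inr ⟨x, hx, h2 hy⟩)⟩

/-- The earlier proposals of the author of a certified vertex lie in its history. -/
theorem Certified.earlier_proposal (hE : E.IsExecution) (hn : 4 * P.f < P.n) {v : V}
    (hv : E.Certified v) (ha : E.author v ∈ E.correct) {ρ : ℕ} {u : V} (hρ : ρ ≤ E.round v)
    (hu : E.proposal (E.author v) ρ = some u) : u ∈ E.history v := by
  obtain ⟨k, hk⟩ : ∃ k, E.round v = k := ⟨_, rfl⟩
  induction k generalizing v with
  | zero =>
    have := hv.proposal hE hn ha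
    rw [show E.round v = ρ by omega, hu] at this
    simp only [Option.some.injEq] at this
    exact this ▸ mem_history_self u
  | succ k ih =>
    have hp := hv.proposal hE hn ha
    rcases hρ.eq_or_lt with h | h
    · rw [← h, hu] at hp
      simp only [Option.some.injEq] at hp
      exact hp ▸ mem_history_self u
    · rw [hk] at hp
      -- The chain of self-references leads back through all earlier proposals of the author.
      obtain ⟨x, hx, hxv⟩ := hE.self_reference _ ha k v hp
      obtain ⟨hxa, hxr⟩ := hE.proposal_header _ ha k x hx
      refine (hv.mem_history_iff hE hn).2 (.inr ⟨x, hxv, ?_⟩)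
      exact ih (hv.parent hE hn hxv).2 (by rwa [hxa]) (by omega) (by rwa [hxa]) hxr

theorem IsLeader.unique (hE : E.IsExecution) (hn : 4 * P.f < P.n) {w : ℕ} {u v : V}
    (hu : E.IsLeader w u) (hv : E.IsLeader w v) (huc : E.Certified u) (hvc : E.Certified v) :
    u = v :=
  huc.unique hE hn hvc (hu.2.trans hv.2.symm) (hu.1.trans hv.1.symm)

/-- By uniqueness of certified vertices, the choice in `leaderIn` does not matter. -/
theorem leaderIn_history (hE : E.IsExecution) (hn : 4 * P.f < P.n) {w : ℕ} {u v : V}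
    (hv : E.Certified v) (hu : u ∈ E.history v) (hl : E.IsLeader w u) :
    E.leaderIn (E.history v) w = some u := by
  have hex : ∃ x, x ∈ E.history v ∧ E.IsLeader w x := ⟨u, hu, hl⟩
  unfold leaderIn
  rw [dif_pos hex]
  have := hex.choose_spec
  exact congrArg some (this.2.unique hE hn hl (hv.of_mem_history hE hn this.1).1
    (hv.of_mem_history hE hn hu).1)

variable (E) in
/-- A leader vertex with the support in the next round that a direct commit requires. -/
def DirectlyCommittable (w : ℕ) (v : V) : Prop :=
  E.Certified v ∧ E.IsLeader w v ∧ ∃ S : Finset V, P.f + 1 ≤ S.card ∧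
    ∀ u ∈ S, E.Certified u ∧ E.round u = E.round v + 1 ∧ v ∈ E.parents u

/-- A directly committed leader is in the history of every later certified vertex. -/
theorem DirectlyCommittable.mem_history (hE : E.IsExecution) (hn : 4 * P.f < P.n) {w : ℕ} {v x : V}
    (hv : E.DirectlyCommittable w v) (hx : E.Certified x) (hr : E.round v + 2 ≤ E.round x) :
    v ∈ E.history x := by
  obtain ⟨hvc, hl, S, hS, hSv⟩ := hv
  obtain ⟨k, hk⟩ : ∃ k, E.round x = k := ⟨_, rfl⟩
  induction k using Nat.strong_induction_on generalizing x with
  | _ k ih =>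
    have hpar := hx.card_parents hE hn (by omega)
    -- Two rounds above `v`, the `n - f` authors referenced by `x` meet the `f + 1` authors of
    -- supporters of `v`; by uniqueness the vertices coincide. In later rounds any reference of `x`
    -- leads down to this case.
    by_cases h2 : E.round x = E.round v + 2
    · have hinj : (S.image E.author).card = S.card := by
        refine Finset.card_image_of_injOn fun a ha b hb hab => ?_
        have ha := hSv a ha
        have hb := hSv b hb
        exact ha.1.unique hE hn hb.1 hab (ha.2.1.trans hb.2.1.symm)
      have h3 := card_inter_ge (Q := (E.parents x).image E.author) (Q' := S.image E.author)
      obtain ⟨j, hj⟩ := Finset.card_pos.1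
        (show 0 < ((E.parents x).image E.author ∩ S.image E.author).card by omega)
      simp only [Finset.mem_inter, Finset.mem_image] at hj
      obtain ⟨⟨a, ha, haj⟩, b, hb, hbj⟩ := hj
      obtain ⟨har, hac⟩ := hx.parent hE hn ha
      obtain ⟨hbc, hbr, hvb⟩ := hSv b hb
      obtain rfl : a = b := hac.unique hE hn hbc (haj.trans hbj.symm) (by omega)
      exact (hx.mem_history_iff hE hn).2 (.inr ⟨a, ha,
        (hac.mem_history_iff hE hn).2 (.inr ⟨v, hvb, mem_history_self v⟩)⟩)
    · obtain ⟨j, hj⟩ := Finset.card_pos.1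
        (show 0 < ((E.parents x).image E.author).card by omega)
      obtain ⟨a, ha, -⟩ := Finset.mem_image.1 hj
      obtain ⟨har, hac⟩ := hx.parent hE hn ha
      exact (hx.mem_history_iff hE hn).2
        (.inr ⟨a, ha, ih (E.round a) (by omega) hac (by omega) rfl⟩)

theorem leaderChain_certified (hE : E.IsExecution) (hn : 4 * P.f < P.n) {lo m : ℕ} {cur : V}
    (hc : E.Certified cur) : ∀ v ∈ E.leaderChain lo m cur, E.Certified v := by
  induction m generalizing cur with
  | zero => simpa [leaderChain] using hc
  | succ m ih =>
    intro v hv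
    unfold leaderChain at hv
    split at hv
    · exact ih hc v hv
    · next u hu =>
      rcases List.mem_append.1 hv with h | h
      · exact ih (hc.of_mem_history hE hn (leaderIn_eq_some hu).1).1 v h
      · rw [List.mem_singleton] at h
        exact h ▸ hc

/-- Going back through the waves, one meets every directly committed leader. -/
theorem leaderChain_eq_append (hE : E.IsExecution) (hn : 4 * P.f < P.n) {w m : ℕ} {v cur : V}
    (hv : E.DirectlyCommittable w v) (hc : E.Certified cur)
    (hr : P.waveLength * (w + 1) ≤ E.round cur) :
    E.leaderChain 0 (w + 1 + m) cur = E.leaderChain 0 w v ++ E.leaderChain (w + 1) m cur := by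
  have h2 := P.two_le_waveLength
  induction m generalizing cur with
  | zero =>
    -- The current leader is at least one wave, hence at least two rounds, above `v`.
    have hmem : v ∈ E.history cur := by
      refine hv.mem_history hE hn hc ?_
      rw [hv.2.1.1]
      rw [Nat.mul_succ] at hr
      omega
    have hl : E.leaderIn (E.history cur) (0 + w) = some v := by
      rw [Nat.zero_add]
      exact leaderIn_history hE hn hc hmem hv.2.1
    rw [Nat.add_zero]
    conv_lhs => unfold leaderChain
    rw [hl]
    simp [leaderChain]
  | succ m ih =>
    rw [← Nat.add_assoc]
    conv_lhs => unfold leaderChain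
    conv_rhs => rw [leaderChain]
    rw [Nat.zero_add]
    cases hl : E.leaderIn (E.history cur) (w + 1 + m) with
    | none => exact ih hc hr
    | some u =>
      obtain ⟨hu, hlu⟩ := leaderIn_eq_some hl
      simp only
      rw [ih (hc.of_mem_history hE hn hu).1 ?_, List.append_assoc]
      rw [hlu.1]
      exact Nat.mul_le_mul_left _ (Nat.le_add_right _ _)

/-- The leaders committed by a correct replica are determined by the last direct commit. -/
theorem leaders_eq (hE : E.IsExecution) (hn : 4 * P.f < P.n) {i : Fin P.n} (hi : i ∈ E.correct)
    (t : ℕ) : E.commitState i t = ([], 0) ∨ ∃ w v, E.DirectlyCommittable w v ∧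
      E.commitState i t = (E.leaderChain 0 w v, w + 1) := by
  induction t with
  | zero => exact .inl rfl
  | succ t ih =>
    unfold commitState
    cases hw : E.commitWave i t with
    | none => exact ih
    | some w =>
      obtain ⟨hlo, v, hv, hcard⟩ := hE.commit_rule i hi t w hw
      simp only [hv]
      obtain ⟨hvm, hvl⟩ := leaderIn_eq_some hv
      have hdc : E.DirectlyCommittable w v := by
        refine ⟨hE.view_certified i hi t v hvm, hvl, _, hcard, fun u hu => ?_⟩
        obtain ⟨h1, h2, h3⟩ := Finset.mem_filter.1 hu
        exact ⟨hE.view_certified i hi t u h1, h2, h3⟩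
      refine .inr ⟨w, v, hdc, ?_⟩
      rcases ih with ih | ⟨w', v', hdc', ih⟩
      · simp [ih]
      · rw [ih] at hlo ⊢
        simp only at hlo ⊢
        -- A walk that stops behind the last direct commit, appended to the old chain, equals a
        -- single walk down to wave `0`.
        rw [← leaderChain_eq_append hE hn hdc' hdc.1, Nat.add_sub_cancel' hlo]
        rw [hvl.1]
        exact Nat.mul_le_mul_left _ hlo

theorem leaders_certified (hE : E.IsExecution) (hn : 4 * P.f < P.n) {i : Fin P.n}
    (hi : i ∈ E.correct) (t : ℕ) : ∀ v ∈ E.leaders i t, E.Certified v := by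
  unfold leaders
  rcases leaders_eq hE hn hi t with h | ⟨w, v, hv, h⟩
  · simp [h]
  · rw [h]
    exact leaderChain_certified hE hn hv.1

/-- Agreement: the commit sequences of two correct replicas are comparable. -/
theorem leaders_prefix_or (hE : E.IsExecution) (hn : 4 * P.f < P.n) {i j : Fin P.n}
    (hi : i ∈ E.correct) (hj : j ∈ E.correct) (t t' : ℕ) :
    E.leaders i t <+: E.leaders j t' ∨ E.leaders j t' <+: E.leaders i t := by
  have key : ∀ w v w' v', E.DirectlyCommittable w v → E.DirectlyCommittable w' v' → w < w' →
      E.leaderChain 0 w v <+: E.leaderChain 0 w' v' := by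
    intro w v w' v' h h' hlt
    obtain ⟨m, rfl⟩ := Nat.exists_eq_add_of_le (Nat.succ_le_of_lt hlt)
    rw [Nat.succ_eq_add_one, leaderChain_eq_append hE hn h h'.1]
    · exact List.prefix_append _ _
    · rw [h'.2.1.1]
      exact Nat.mul_le_mul_left _ (Nat.le_add_right _ _)
  unfold leaders
  rcases leaders_eq hE hn hi t with h | ⟨w, v, hv, h⟩
  · simp [h]
  rcases leaders_eq hE hn hj t' with h' | ⟨w', v', hv', h'⟩
  · simp [h']
  rw [h, h']
  rcases lt_trichotomy w w' with hlt | rfl | hlt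
  · exact .inl (key _ _ _ _ hv hv' hlt)
  · obtain rfl := hv.2.1.unique hE hn hv'.2.1 hv.1 hv'.1
    exact .inl (List.prefix_refl _)
  · exact .inr (key _ _ _ _ hv' hv hlt)

end Consensus

/-! ### Cumulative orderings reflect receive orders -/

section Orderings

variable {Tx : Type*} [LinearOrder Tx] {P : Params Tx} {V : Type*} {E : Trace P V}

theorem mem_ordering {ls : List V} {r : ℕ} (hr : r ≤ ls.length) {j : Fin P.n} {x : Tx} :
    x ∈ E.ordering ls j r ↔ ∃ v, (∃ l ∈ ls.take r, v ∈ E.history l) ∧ E.author v = j ∧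
      ∃ e ∈ E.entries v, e.1 = x := by
  simp only [← mem_biUnion_subdag hr]
  clear hr
  induction r with
  | zero => simp [ordering]
  | succ r ih =>
    rw [ordering, mem_ingest, ih, mem_contribution]
    constructor
    · rintro (⟨v, ⟨k, hk, hv⟩, h⟩ | ⟨v, hv, h⟩)
      · exact ⟨v, ⟨k, by omega, hv⟩, h⟩
      · exact ⟨v, ⟨r, by omega, hv⟩, h⟩
    · rintro ⟨v, ⟨k, hk, hv⟩, h⟩
      rcases Nat.lt_succ_iff_lt_or_eq.1 hk with hk | rfl
      · exact .inl ⟨v, ⟨k, hk, hv⟩, h⟩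
      · exact .inr ⟨v, hv, h⟩

/-- A transaction in the cumulative ordering of a correct replica has been received, and all
transactions received earlier are in the ordering, too. -/
theorem ordering_closed (hE : E.IsExecution) (hn : 4 * P.f < P.n) {ls : List V}
    (hls : ∀ v ∈ ls, E.Certified v) {r : ℕ} (hr : r ≤ ls.length) {j : Fin P.n}
    (hj : j ∈ E.correct) {x : Tx} (hx : x ∈ E.ordering ls j r) :
    E.recv j x ≠ ⊤ ∧ ∀ y, E.recv j y < E.recv j x → y ∈ E.ordering ls j r := by
  obtain ⟨v, ⟨l, hl, hv⟩, hva, e, he, rfl⟩ := (mem_ordering hr).1 hx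
  have hlc := hls l (List.mem_of_mem_take hl)
  obtain ⟨hvc, hvl⟩ := hlc.of_mem_history hE hn hv
  have hp := hvc.proposal hE hn (by rwa [hva])
  rw [hva] at hp
  refine ⟨?_, fun y hy => ?_⟩
  · rw [hE.entries_loi j hj _ v hp e he]
    exact ENat.natCast_ne_top _
  -- Gap-free sealing puts `y` into the same or an earlier proposal of `j`, which the history of the
  -- same leader contains.
  · obtain ⟨ρ, hρ, u, hu, e', he', rfl⟩ := hE.entries_sealed j hj _ v hp e he y hy
    have hmem := hvc.earlier_proposal hE hn (by rwa [hva]) hρ (by rwa [hva])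
    exact (mem_ordering hr).2
      ⟨u, ⟨l, hl, hvl hmem⟩, (hE.proposal_header j hj ρ u hu).1, e', he', rfl⟩

theorem pairwise_ordering (hE : E.IsExecution) (hn : 4 * P.f < P.n) {ls : List V}
    (hls : ∀ v ∈ ls, E.Certified v) {r : ℕ} (hr : r ≤ ls.length) {j : Fin P.n}
    (hj : j ∈ E.correct) :
    (E.ordering ls j r).Pairwise (fun a b => E.recv j a ≤ E.recv j b) := by
  induction r with
  | zero => exact List.Pairwise.nil
  | succ r ih =>
    refine pairwise_ingest (ih (by omega)) (pairwise_contribution fun v hv hva e he => ?_)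
      fun a ha b hb hbo => ?_
    · obtain ⟨l, hl, hvl⟩ := (mem_biUnion_subdag hr).1 ⟨r, Nat.lt_succ_self r, hv⟩
      have hvc := ((hls l (List.mem_of_mem_take hl)).of_mem_history hE hn hvl).1
      have hp := hvc.proposal hE hn (by rwa [hva])
      rw [hva] at hp
      exact hE.entries_loi j hj _ v hp e he
    -- A new transaction received before an old one would have been in the old ordering, by closure.
    · by_contra hlt
      exact hbo ((ordering_closed hE hn hls (by omega) hj ha).2 b (not_le.1 hlt))

/-- The cumulative orderings of correct replicas reflect the receive orders. -/
theorem recv_lt_of_placesBefore (hE : E.IsExecution) (hn : 4 * P.f < P.n) {ls : List V}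
    (hls : ∀ v ∈ ls, E.Certified v) {r : ℕ} (hr : r ≤ ls.length) {j : Fin P.n}
    (hj : j ∈ E.correct) {u v : Tx} (huv : u ≠ v) (h : PlacesBefore (E.ordering ls j r) u v) :
    E.recv j u < E.recv j v := by
  obtain ⟨hu, hv⟩ := h
  obtain ⟨htop, hcl⟩ := ordering_closed hE hn hls hr hj hu
  have hne : E.recv j u ≠ E.recv j v := fun h => huv (hE.recv_injective j hj u v h htop)
  by_cases hvm : v ∈ E.ordering ls j r
  · exact lt_of_le_of_ne
      (rel_of_idxOf_lt (pairwise_ordering hE hn hls hr hj) hvm (hv hvm)) hne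
  · exact lt_of_le_of_ne (not_lt.1 fun h => hvm (hcl v h)) hne

end Orderings

end Trace

end Herring

end

noncomputable section

namespace Herring

namespace Trace

/-! ### Agreement on tasks, Condorcet edges, and the output order -/

section Tasks

variable {Tx : Type*} [LinearOrder Tx] {P : Params Tx} {V : Type*} {E : Trace P V}

theorem mem_taskResults {ls : List V} {ret : ℕ → Finset ℕ} {r : ℕ} {T : TaskResult Tx} :
    T ∈ E.taskResults ls ret r ↔ ∃ q < r, T = E.task ls ret q := by
  induction r with
  | zero => simp [taskResults]
  | succ r ih =>
    simp only [taskResults, List.mem_append, ih, List.mem_singleton, Nat.lt_succ_iff_lt_or_eq]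
    constructor
    · rintro (⟨q, hq, h⟩ | h)
      · exact ⟨q, .inl hq, h⟩
      · exact ⟨r, .inr rfl, h⟩
    · rintro ⟨q, hq | rfl, h⟩
      · exact .inl ⟨q, hq, h⟩
      · exact .inr h

theorem mem_priorCumulative {prev : List (TaskResult Tx)} {x : Tx} :
    x ∈ priorCumulative prev ↔ ∃ T ∈ prev, x ∈ T.graph.verts := by
  simp [priorCumulative]

theorem mem_prior {ls : List V} {ret : ℕ → Finset ℕ} {r : ℕ} {x : Tx} :
    x ∈ priorCumulative (E.taskResults ls ret r) ↔
      ∃ q < r, x ∈ (E.task ls ret q).graph.verts := by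
  rw [mem_priorCumulative]
  constructor
  · rintro ⟨T, hT, hx⟩
    obtain ⟨q, hq, rfl⟩ := mem_taskResults.1 hT
    exact ⟨q, hq, hx⟩
  · rintro ⟨q, hq, hx⟩
    exact ⟨_, mem_taskResults.2 ⟨q, hq, rfl⟩, hx⟩

theorem excluded_subset (hP : 2 * P.tau + 2 * P.f ≤ P.n + 1) (ls : List V) (ret : ℕ → Finset ℕ)
    (s : Finset ℕ) (r : ℕ) :
    excluded (E.taskResults ls ret r) s ⊆ priorCumulative (E.taskResults ls ret r) := by
  intro x hx
  simp only [excluded, Finset.mem_biUnion, Finset.mem_range] at hx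
  obtain ⟨q, hq, hx⟩ := hx
  rw [List.getElem?_eq_getElem hq] at hx
  obtain ⟨k, hk, hT⟩ := mem_taskResults.1 (List.getElem_mem hq)
  simp only [hT] at hx
  rw [mem_prior]
  -- Retained or merely claimed as solid, the transaction lies in some earlier graph, whichever
  -- tasks have returned.
  split_ifs at hx
  · exact ⟨k, hk, hx⟩
  · rcases Finset.mem_union.1 (buildTask_solid_subset hP hx) with h | h
    · exact ⟨k, hk, h⟩
    · obtain ⟨q', hq', h⟩ := mem_prior.1 h
      exact ⟨q', hq'.trans hk, h⟩

variable (E) in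
/-- The graph construction task on the cumulative orderings, nothing being omitted from them. -/
def unfilteredTask (ls : List V) (ret : ℕ → Finset ℕ) (r : ℕ) : TaskResult Tx :=
  buildTask P (fun j => E.ordering ls j (r + 1)) (priorCumulative (E.taskResults ls ret r))

theorem task_eq_unfilteredTask (hP : 2 * P.tau + 2 * P.f ≤ P.n + 1) (ls : List V)
    (ret : ℕ → Finset ℕ) (r : ℕ) :
    (E.task ls ret r).graph = (E.unfilteredTask ls ret r).graph ∧
      (E.task ls ret r).missing = (E.unfilteredTask ls ret r).missing ∧
      (E.task ls ret r).anchor = (E.unfilteredTask ls ret r).anchor :=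
  buildTask_filter (excluded_subset hP ls ret (ret r) r)

theorem ordering_append (ls x : List V) (j : Fin P.n) {r : ℕ} (hr : r ≤ ls.length) :
    E.ordering (ls ++ x) j r = E.ordering ls j r := by
  induction r with
  | zero => rfl
  | succ r ih => rw [ordering, ordering, ih (by omega), subdag_append ls x (by omega)]

/-- The outcome of a task depends on the committed leaders only. -/
theorem task_agree (hP : 2 * P.tau + 2 * P.f ≤ P.n + 1) {ls ls' : List V} (hls : ls <+: ls')
    (ret ret' : ℕ → Finset ℕ) {r : ℕ} (hr : r < ls.length) :
    (E.task ls ret r).graph = (E.task ls' ret' r).graph ∧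
      (E.task ls ret r).missing = (E.task ls' ret' r).missing := by
  induction r using Nat.strong_induction_on with
  | _ r ih =>
    obtain ⟨x, rfl⟩ := hls
    -- The only remaining dependence on `ret` is through the earlier graphs, which agree by
    -- induction.
    have hprior : priorCumulative (E.taskResults ls ret r) =
        priorCumulative (E.taskResults (ls ++ x) ret' r) := by
      ext y
      simp only [mem_prior]
      exact exists_congr fun q => and_congr_right fun hq => by rw [(ih q hq (hq.trans hr)).1]
    have h : E.unfilteredTask ls ret r = E.unfilteredTask (ls ++ x) ret' r := by
      unfold unfilteredTask
      simp only [hprior, ordering_append ls x _ (Nat.succ_le_of_lt hr)]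
    obtain ⟨h1, h2, -⟩ := task_eq_unfilteredTask (E := E) hP ls ret r
    obtain ⟨h1', h2', -⟩ := task_eq_unfilteredTask (E := E) hP (ls ++ x) ret' r
    exact ⟨by rw [h1, h1', h], by rw [h2, h2', h]⟩

/-- Removing at most `f` Byzantine members leaves `⌊n (1 - γ)⌋ + 1 > n (1 - γ)` correct ones; this
is the reason for the value of `τ`. -/
theorem condorcetEdge_of_card (hE : E.IsExecution) {a b : Tx} {Q : Finset (Fin P.n)}
    (hQ : P.tau ≤ Q.card) (h : ∀ j ∈ Q, j ∈ E.correct → E.recv j a < E.recv j b) :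
    E.CondorcetEdge a b := by
  have h1 := card_le_inter_correct hE hQ
  have h2 : (Q ∩ E.correct).card ≤
      (E.correct.filter (fun i => E.recv i a < E.recv i b)).card := by
    refine Finset.card_le_card fun j hj => ?_
    obtain ⟨hjQ, hjc⟩ := Finset.mem_inter.1 hj
    exact Finset.mem_filter.2 ⟨hjc, h j hjQ hjc⟩
  unfold CondorcetEdge
  refine (Nat.lt_floor_add_one _).trans_le ?_
  unfold Params.tau at h1
  exact_mod_cast (show ⌊(P.n : ℝ) * (1 - P.γ)⌋₊ + 1 ≤ _ by omega)

theorem condorcetEdge_of_weight (hE : E.IsExecution) (hn : 4 * P.f < P.n) {ls : List V}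
    (hls : ∀ v ∈ ls, E.Certified v) {r : ℕ} (hr : r ≤ ls.length) {a b : Tx} (hab : a ≠ b)
    (hw : P.tau ≤ weight P (fun j => E.ordering ls j r) a b) : E.CondorcetEdge a b :=
  condorcetEdge_of_card hE hw fun _ hj hjc =>
    recv_lt_of_placesBefore hE hn hls hr hjc hab (Finset.mem_filter.1 hj).2

/-- What is retained for a subdag reaches, along Condorcet edges, whatever is retained later or not
at all. -/
theorem reach_of_not_retained (hE : E.IsExecution) (hn : 4 * P.f < P.n)
    (hP : 2 * P.tau + 2 * P.f ≤ P.n + 1) {ls : List V} (hls : ∀ v ∈ ls, E.Certified v)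
    {ret : ℕ → Finset ℕ} {r : ℕ} (hr : r < ls.length) {a b : Tx}
    (ha : a ∈ (E.task ls ret r).graph.verts)
    (hb : ∀ q ≤ r, b ∉ (E.task ls ret q).graph.verts) :
    Relation.ReflTransGen E.CondorcetEdge a b := by
  have hgr := (task_eq_unfilteredTask (E := E) hP ls ret r).1
  have hbr := hb r le_rfl
  rw [hgr] at ha hbr
  obtain ⟨z, hz, hz'⟩ := exists_anchor hP ha
  have hbp : b ∉ priorCumulative (E.taskResults ls ret r) := fun h => by
    obtain ⟨q, hq, h⟩ := mem_prior.1 h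
    exact hb q hq.le h
  obtain ⟨hzb, hw⟩ := hz' b hbp hbr
  -- The path runs from `a` to the anchor `z` in the graph, then directly to `b`.
  refine Relation.ReflTransGen.tail ?_ (condorcetEdge_of_weight hE hn hls hr hzb hw)
  refine Relation.ReflTransGen.mono (fun u v huv => ?_) _ _ (hz a ha)
  obtain ⟨huv, hw⟩ := of_mem_fullGraph_edges huv
  exact condorcetEdge_of_weight hE hn hls hr huv hw

/-- The votes of a correct replica that has voted on a subdag of a correct replica `i` direct
all missing pairs, and only in receive order. -/
theorem votesOf_correct (hE : E.IsExecution) (hn : 4 * P.f < P.n)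
    (hP : 2 * P.tau + 2 * P.f ≤ P.n + 1) {i : Fin P.n} (hi : i ∈ E.correct) {t q r : ℕ}
    (hq : q ≤ (E.leaders i t).length) (hr : r < (E.leaders i t).length) {j : Fin P.n}
    (hj : j ∈ E.correct) :
    (∀ a b, (a, b) ∈ E.votesOf (E.leaders i t) q r j → E.recv j a < E.recv j b) ∧
      (j ∈ E.voters (E.leaders i t) q r → ∀ a b, (a, b) ∈ (E.taskAt i t r).missing →
        (a, b) ∈ E.votesOf (E.leaders i t) q r j ∨ (b, a) ∈ E.votesOf (E.leaders i t) q r j) := by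
  have hvote : ∀ v ∈ E.committedBy (E.leaders i t) q j, ∀ b ∈ E.votes v, b.1 = r →
      b.2 = E.directedVote j (E.taskAt i t r).missing ∧
        ∀ p ∈ (E.taskAt i t r).missing, E.recv j p.1 ≠ ⊤ ∧ E.recv j p.2 ≠ ⊤ := by
    intro v hv b hb hbr
    simp only [committedBy, Finset.mem_filter, Finset.mem_biUnion, Finset.mem_range] at hv
    obtain ⟨⟨k, hk, hv⟩, hva⟩ := hv
    obtain ⟨l, hl, hvl⟩ := (mem_biUnion_subdag hq).1 ⟨k, hk, hv⟩
    have hlc := leaders_certified hE hn hi t l (List.mem_of_mem_take hl)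
    have hp := (hlc.of_mem_history hE hn hvl).1.proposal hE hn (by rwa [hva])
    rw [hva] at hp
    obtain ⟨t', ht', -, hM, hb2⟩ := hE.votes_honest j hj _ v hp b hb
    rw [hbr] at ht' hM hb2
    -- The voter `j` judged by its own commits and task timing; agreement transfers the missing
    -- pairs to `i`.
    have hag : (E.taskAt j t' r).missing = (E.taskAt i t r).missing := by
      rcases leaders_prefix_or hE hn hi hj t t' with h | h
      · exact (task_agree hP h _ _ hr).2.symm
      · exact (task_agree hP h _ _ ht').2
    rw [hag] at hM hb2
    exact ⟨hb2, hM⟩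
  constructor
  · intro a b hab
    simp only [votesOf, Finset.mem_biUnion, List.mem_toFinset, List.mem_filter,
      decide_eq_true_eq] at hab
    obtain ⟨v, hv, c, ⟨hc, hcr⟩, hab⟩ := hab
    obtain ⟨h1, h2⟩ := hvote v hv c hc hcr
    rw [h1] at hab
    simp only [directedVote, Finset.mem_image] at hab
    obtain ⟨⟨x, y⟩, hxy, h⟩ := hab
    -- Both LOIs are known, so there are no ties and the default branch of `directedVote` is a
    -- strict inequality too.
    have hne : E.recv j x ≠ E.recv j y := fun h =>
      (mem_buildTask_missing.1 hxy).2.2.1.ne (hE.recv_injective j hj x y h (h2 _ hxy).1)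
    split_ifs at h with hlt <;> simp only [Prod.mk.injEq] at h hlt <;> obtain ⟨rfl, rfl⟩ := h
    · exact hlt
    · exact lt_of_le_of_ne (not_lt.1 hlt) hne.symm
  · intro hjv a b hab
    simp only [voters, Finset.mem_filter, Finset.mem_univ, true_and] at hjv
    obtain ⟨v, hv, c, hc, hcr⟩ := hjv
    have h1 := (hvote v hv c hc hcr).1
    have hsub : c.2 ⊆ E.votesOf (E.leaders i t) q r j := fun x hx => by
      simp only [votesOf, Finset.mem_biUnion, List.mem_toFinset, List.mem_filter,
        decide_eq_true_eq]
      exact ⟨v, hv, c, ⟨hc, hcr⟩, hx⟩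
    rw [h1] at hsub
    by_cases hlt : E.recv j a < E.recv j b
    · exact .inl (hsub (Finset.mem_image.2 ⟨(a, b), hab, by simp [hlt]⟩))
    · exact .inr (hsub (Finset.mem_image.2 ⟨(a, b), hab, by simp [hlt]⟩))

/-- The order that a correct replica emits for a subdag consists of the retained transactions, and
earlier transactions reach later ones along Condorcet edges. -/
theorem order_spec (hE : E.IsExecution) (hn : 4 * P.f < P.n)
    (hP : 2 * P.tau + 2 * P.f ≤ P.n + 1) {i : Fin P.n} (hi : i ∈ E.correct) {t r : ℕ}
    (hr : r < E.emitted i t) :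
    (∀ u, u ∈ E.order i t r ↔ u ∈ (E.taskAt i t r).graph.verts) ∧
      (E.order i t r).Pairwise (Relation.ReflTransGen E.CondorcetEdge) := by
  obtain ⟨hlen, hemit⟩ := hE.emit_rule i hi t
  have hemit := hemit r hr
  have hrl : r < (E.leaders i t).length := hr.trans_le hlen
  have hls := leaders_certified hE hn hi t
  obtain ⟨hg, hm, hanc⟩ := task_eq_unfilteredTask (E := E) hP (E.leaders i t) (E.returned i) r
  set T := E.unfilteredTask (E.leaders i t) (E.returned i) r with hT
  have hTg : (E.taskAt i t r).graph = T.graph := hg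
  have hTm : (E.taskAt i t r).missing = T.missing := hm
  have hTa : (E.taskAt i t r).anchor = T.anchor := hanc
  have hgedge : ∀ a b, (a, b) ∈ T.graph.edges → E.CondorcetEdge a b := by
    intro a b hab
    obtain ⟨hne, hw⟩ := of_mem_buildTask_edges hab
    exact condorcetEdge_of_weight hE hn hls hrl hne hw
  -- Here `H` is the truncated graph or its completion by votes; both are complete and have
  -- Condorcet edges only.
  suffices h : ∃ H : DepGraph Tx, E.order i t r = finalize P H T.anchor ∧ H.WellFormed ∧
      H.verts = T.graph.verts ∧ T.graph.edges ⊆ H.edges ∧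
      (∀ a b, (a, b) ∈ H.edges → E.CondorcetEdge a b) ∧
      ∀ a b, (a, b) ∈ T.missing → (a, b) ∈ H.edges ∨ (b, a) ∈ H.edges by
    obtain ⟨H, ho, hwf, hv, he, hc, hmis⟩ := h
    have hcomp : ∀ a ∈ H.verts, ∀ b ∈ H.verts, a < b → (a, b) ∈ H.edges ∨ (b, a) ∈ H.edges := by
      intro a ha b hb hab
      rw [hv] at ha hb
      rcases buildTask_edge_or ha hb hab with h | h | h
      · exact .inl (he h)
      · exact .inr (he h)
      · exact hmis a b h
    rw [ho, hTg]
    refine ⟨fun u => ?_, ?_⟩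
    · rw [← hv]
      exact mem_finalize hwf hv he
    · refine (pairwise_finalize hwf (fun a ha b hb hab => ?_) _).imp fun {a b} hab =>
        Relation.ReflTransGen.mono hc _ _ hab
      rcases lt_or_gt_of_ne hab with h | h
      · exact hcomp a ha b hb h
      · exact (hcomp b hb a ha h).symm
  unfold order
  by_cases hmis : (E.taskAt i t r).missing = ∅
  · refine ⟨T.graph, ?_, buildTask_wellFormed _ _, rfl, subset_rfl, hgedge, ?_⟩
    · rw [if_pos hmis, hTg, hTa]
    · intro a b hab
      rw [← hTm, hmis] at hab
      simp at hab
  obtain ⟨hq, hvot⟩ := hemit hmis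
  set q := E.resolvedAt i r
  set vts := E.votesOf (E.leaders i t) q r with hvts
  refine ⟨applyFairUpdate P T vts, ?_, applyFairUpdate_wellFormed _ _ _, rfl,
    Finset.subset_union_left, ?_, ?_⟩
  · rw [if_neg hmis, hTa]
    simp only [applyFairUpdate, hTg, hTm]
  · intro a b hab
    rcases Finset.mem_union.1 hab with h | h
    · exact hgedge a b h
    · refine condorcetEdge_of_card hE (of_mem_tallyEdges h).1 fun j hjm hjc => ?_
      exact (votesOf_correct hE hn hP hi hq hrl hjc).1 a b (Finset.mem_filter.1 hjm).2
  · intro a b hab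
    -- At least `n - 2 f` of the voters are correct, and each directs the pair. Byzantine votes can
    -- only increase the tallies.
    have hcount : P.n - 2 * P.f ≤
        (Finset.univ.filter (fun j => (a, b) ∈ vts j)).card +
          (Finset.univ.filter (fun j => (b, a) ∈ vts j)).card := by
      have h1 := card_le_inter_correct hE hvot
      refine le_trans (show _ ≤ P.n - P.f - P.f by omega) (h1.trans ?_)
      refine le_trans (Finset.card_le_card fun j hj => ?_) (Finset.card_union_le _ _)
      obtain ⟨hjv, hjc⟩ := Finset.mem_inter.1 hj
      simp only [Finset.mem_union, Finset.mem_filter, Finset.mem_univ, true_and]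
      exact (votesOf_correct hE hn hP hi hq hrl hjc).2 hjv a b (by rwa [hTm])
    have hedge : P.tau ≤ max (Finset.univ.filter (fun j => (a, b) ∈ vts j)).card
        (Finset.univ.filter (fun j => (b, a) ∈ vts j)).card := by
      have h2 := le_max_left (Finset.univ.filter (fun j => (a, b) ∈ vts j)).card
        (Finset.univ.filter (fun j => (b, a) ∈ vts j)).card
      have h3 := le_max_right (Finset.univ.filter (fun j => (a, b) ∈ vts j)).card
        (Finset.univ.filter (fun j => (b, a) ∈ vts j)).card
      omega
    exact (mem_tallyEdges_or (w := fun u v => (Finset.univ.filter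
      (fun j => (u, v) ∈ vts j)).card) hab hedge).imp
      (Finset.mem_union_right _) (Finset.mem_union_right _)

/-- Along Condorcet edges, an output transaction reaches all that are output after it and all that
are not output. -/
theorem log_spec (hE : E.IsExecution) (hn : 4 * P.f < P.n)
    (hP : 2 * P.tau + 2 * P.f ≤ P.n + 1) {i : Fin P.n} (hi : i ∈ E.correct) (t : ℕ) :
    (E.log i t).Pairwise (Relation.ReflTransGen E.CondorcetEdge) ∧
      ∀ a ∈ E.log i t, ∀ b ∉ E.log i t, Relation.ReflTransGen E.CondorcetEdge a b := by
  have hlen := (hE.emit_rule i hi t).1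
  have hls := leaders_certified hE hn hi t
  have hmem : ∀ r < E.emitted i t, ∀ u, u ∈ E.order i t r ↔
      u ∈ (E.taskAt i t r).graph.verts := fun r hr => (order_spec hE hn hP hi hr).1
  have hreach : ∀ r < E.emitted i t, ∀ a ∈ E.order i t r, ∀ b,
      (∀ q ≤ r, b ∉ E.order i t q) → Relation.ReflTransGen E.CondorcetEdge a b := by
    intro r hr a ha b hb
    refine reach_of_not_retained hE hn hP hls (hr.trans_le hlen) ((hmem r hr a).1 ha)
      fun q hq h => ?_
    exact hb q hq ((hmem q (hq.trans_lt hr) b).2 h)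
  -- A graph has no vertices of earlier graphs, so transactions of later orders count as not
  -- retained before.
  have hdisj : ∀ q s, q < s → s < E.emitted i t → ∀ b ∈ E.order i t s, b ∉ E.order i t q := by
    intro q s hqs hs b hb hb'
    rw [hmem s hs, taskAt, (task_eq_unfilteredTask hP _ _ _).1, unfilteredTask,
      buildTask_verts] at hb
    rw [hmem q (hqs.trans hs)] at hb'
    exact (mem_freshVerts.1 (mem_keptVerts.1 hb).1).2 (mem_prior.2 ⟨q, hqs, hb'⟩)
  unfold log
  constructor
  · rw [List.pairwise_flatMap]
    refine ⟨fun r hr => (order_spec hE hn hP hi (List.mem_range.1 hr)).2, ?_⟩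
    refine List.Pairwise.imp_of_mem (fun {q s} hq hs hqs a ha b hb => ?_)
      List.pairwise_lt_range
    rw [List.mem_range] at hq hs
    exact hreach q hq a ha b fun k hk => hdisj k s (hk.trans_lt hqs) hs b hb
  · intro a ha b hb
    simp only [List.mem_flatMap, List.mem_range, not_exists, not_and] at ha hb
    obtain ⟨r, hr, ha⟩ := ha
    exact hreach r hr a ha b fun q hq => hb q (hq.trans_lt hr)

end Tasks

end Trace

end Herring

end

theorem theorem1 {Tx V : Type*} [LinearOrder Tx] (P : Herring.Params Tx)
    (hγ : 1 / 2 < P.γ) (hγ' : P.γ ≤ 1)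
    (hn : 4 * (P.f : ℝ) / (2 * P.γ - 1) < (P.n : ℝ))
    (E : Herring.Trace P V) (hE : E.IsExecution)
    (tx tx' : Tx)
    (hrecv : ∀ i : Fin P.n, E.recv i tx ≠ ⊤ ∧ E.recv i tx' ≠ ⊤)
    (hbefore : P.γ * (P.n : ℝ) ≤
      ((Finset.univ.filter (fun i : Fin P.n => E.recv i tx < E.recv i tx')).card : ℝ)) :
    ∀ i ∈ E.correct, ∀ t : ℕ, E.OutputNoLater (E.log i t) tx tx' := by
  have hf : (0 : ℝ) ≤ P.f := Nat.cast_nonneg _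
  have hn0 : (0 : ℝ) ≤ P.n := Nat.cast_nonneg _
  rw [div_lt_iff₀ (by linarith)] at hn
  have hn4 : 4 * P.f < P.n := by
    have : 4 * (P.f : ℝ) < P.n := hn.trans_le (by nlinarith)
    exact_mod_cast this
  -- From `4 f < n (2 γ - 1)` one gets `2 n (1 - γ) + 4 f < n`, and rounding down keeps the
  -- inequality.
  have hP : 2 * P.tau + 2 * P.f ≤ P.n + 1 := by
    have hfl : (⌊(P.n : ℝ) * (1 - P.γ)⌋₊ : ℝ) ≤ P.n * (1 - P.γ) :=
      Nat.floor_le (mul_nonneg hn0 (by linarith))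
    have : 2 * (⌊(P.n : ℝ) * (1 - P.γ)⌋₊ : ℝ) + 4 * P.f < P.n := by linarith
    have : 2 * ⌊(P.n : ℝ) * (1 - P.γ)⌋₊ + 4 * P.f < P.n := by exact_mod_cast this
    unfold Herring.Params.tau
    omega
  have hedge : E.CondorcetEdge tx tx' := by
    have h := Herring.Trace.card_le_inter_correct hE
      (le_refl (Finset.univ.filter (fun i : Fin P.n => E.recv i tx < E.recv i tx')).card)
    rw [Nat.sub_le_iff_le_add, Finset.filter_inter, Finset.univ_inter] at h
    have h : ((Finset.univ.filter (fun i : Fin P.n => E.recv i tx < E.recv i tx')).card : ℝ) ≤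
        (E.correct.filter (fun i => E.recv i tx < E.recv i tx')).card + P.f := by exact_mod_cast h
    unfold Herring.Trace.CondorcetEdge
    linarith
  have hne : tx ≠ tx' := by
    rintro rfl
    simp only [lt_irrefl, Finset.filter_false, Finset.card_empty, Nat.cast_zero] at hbefore
    have : (0 : ℝ) < P.n := by exact_mod_cast (Nat.zero_le _).trans_lt hn4
    nlinarith
  intro i hi t htx'
  obtain ⟨hpw, hout⟩ := Herring.Trace.log_spec hE hn4 hP hi t
  have hle : ∀ a b, b ∈ E.log i t → (E.log i t).idxOf a ≤ (E.log i t).idxOf b →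
      Relation.ReflTransGen E.CondorcetEdge a b := by
    intro a b hb hab
    rcases hab.lt_or_eq with h | h
    · exact Herring.rel_of_idxOf_lt hpw hb h
    · rw [(List.idxOf_inj hb).1 h.symm]
  by_cases hlt : tx ∈ E.log i t ∧ (E.log i t).idxOf tx < (E.log i t).idxOf tx'
  · exact .inl ⟨hlt.1, htx', hlt.2⟩
  -- The two halves of `log_spec` cover the cases of `tx` output after `z` and `tx` not yet output.
  have hback : ∀ z ∈ E.log i t, (tx ∈ E.log i t → (E.log i t).idxOf z ≤ (E.log i t).idxOf tx) →
      Relation.ReflTransGen E.CondorcetEdge z tx := by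
    intro z hz hztx
    by_cases htx : tx ∈ E.log i t
    · exact hle z tx htx (hztx htx)
    · exact hout z hz tx htx
  refine .inr ⟨⟨hback tx' htx' fun htx => not_lt.1 fun h => hlt ⟨htx, h⟩,
    Relation.ReflTransGen.single hedge⟩, fun z hz h1 h2 => ⟨hle tx' z hz h1, ?_⟩⟩
  exact (hback z hz h2).tail hedge
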